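/- Conventions. A Latin square on a finite set $Q$ is a table $L : Q\times Q\to Q$ in which every element of $Q$ appears exactly once in each row and exactly once in each column (equivalently, the Cayley table of a quasigroup on $Q$); its order is $|Q|$. Its Latin square graph $G(L)$ has one vertex for each triple $(a,b,c)\in Q^3$ with $L(a,b)=c$, two distinct triples $(a,b,c)$ and $(x,y,z)$ being adjacent if and only if $a=x$, $b=y$ or $c=z$. A logspace-uniform $\mathsf{AC}^0$ family is a sequence $(C_N)_{N\in\mathbb N}$, where $C_N$ is a Boolean circuit with $N$ input bits (and possibly many output bits) over NOT gates and AND and OR gates of unbounded fan-in, whose depth is $O(1)$ and whose number of gates is $N^{O(1)}$, such that a deterministic Turing machine computes a description of $C_N$ from $1^N$ using $O(\log N)$ work space. A graph on the vertex set $V=\{0,\dots,m-1\}$ is given to a circuit as its adjacency matrix ($m^2$ bits). A Latin square $L'$ on a subset $S\subseteq V$ is written by a circuit as the $m$ bits of the characteristic function of $S$, followed by an $m\times m$ table, each of whose entries is a binary number of $\lceil\log_2 m\rceil$ digits: the entry at $(u,w)$ is $L'(u,w)$ if $u,w\in S$, and $0$ otherwise. Lemma. There is a logspace-uniform $\mathsf{AC}^0$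 family $(C_N)_N$ that recovers a Latin square from every Latin square graph, in the following sense. Let $n\in\mathbb N$, let $L$ be a Latin square of order $n$, and let $G$ be any graph on the vertex set $\{0,\dots,n^2-1\}$ that is isomorphic to $G(L)$. Then, on the adjacency matrix of $G$, the circuit $C_{n^4}$ outputs a Latin square $L'$ of order $n$ with $G(L')\cong G$, whose rows, columns and symbols are indexed by the vertices $x_1,\dots,x_n$ of an $n$-clique $S$ of $G$. -/

import Mathlib

/-! ### Latin squares and their graphs -/

/-- A Latin square whose rows, columns and entries are indexed by `Q` (equivalently, the Cayley
table of a quasigroup on `Q`): every element of `Q` occurs exactly once in each row and in each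
column. A Latin square of order `n` in the narrow sense has `Q = Fin n`. -/
def IsLatinSquare {Q : Type} (L : Q → Q → Q) : Prop :=
  (∀ i, Function.Bijective fun j => L i j) ∧ ∀ j, Function.Bijective fun i => L i j

/-- The Latin square graph: one vertex for each triple `(a, b, c)` with `L a b = c`; two different
triples are adjacent if they agree in at least one position. -/
def latinSquareGraph {Q : Type} (L : Q → Q → Q) :
    SimpleGraph {t : Q × Q × Q // L t.1 t.2.1 = t.2.2} where
  Adj s t := s ≠ t ∧ (s.1.1 = t.1.1 ∨ s.1.2.1 = t.1.2.1 ∨ s.1.2.2 = t.1.2.2)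
  symm := ⟨fun _ _ h =>
    ⟨h.1.symm, h.2.imp Eq.symm fun h' => h'.imp Eq.symm Eq.symm⟩⟩
  loopless := ⟨fun _ h => h.1 rfl⟩

/-! ### Boolean circuits with unbounded fan-in

Gates are labelled by binary words and listed in a topological order. -/

/-- The operation of a gate, with the labels of the gates that feed it. -/
inductive GateOp (N : ℕ) : Type
  | input (i : Fin N)
  | not (a : List Bool)
  | and (as : List (List Bool))
  | or (as : List (List Bool))

/-- The labels of the gates that feed a gate. -/
def GateOp.args {N : ℕ} : GateOp N → List (List Bool)
  | .input _ => []
  | .not a => [a]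
  | .and as => as
  | .or as => as

/-- The value of a gate, from the input string `x` and the values `v` of the gates. -/
def GateOp.eval {N : ℕ} (x : Fin N → Bool) (v : List Bool → Bool) : GateOp N → Bool
  | .input i => x i
  | .not a => !(v a)
  | .and as => as.all v
  | .or as => as.any v

/-- The depth of a gate, from the depths `d` of the gates: input gates have depth `0`, any other
gate is one deeper than the deepest gate that feeds it. -/
def GateOp.depth {N : ℕ} (d : List Bool → ℕ) : GateOp N → ℕ
  | .input _ => 0
  | .not a => d a + 1
  | .and as => (as.map d).foldr max 0 + 1
  | .or as => (as.map d).foldr max 0 + 1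

structure Gate (N : ℕ) : Type where
  label : List Bool
  op : GateOp N

/-- A circuit on `N` input bits: its gates, and the labels of its output gates in order. -/
structure Circuit (N : ℕ) : Type where
  gates : List (Gate N)
  outputs : List (List Bool)

namespace Circuit

variable {N : ℕ}

/-- Gates have different labels, each gate is fed only by gates that stand earlier in the list, and
the outputs are gates of the circuit. -/
def WellFormed (C : Circuit N) : Prop :=
  (C.gates.map Gate.label).Nodup ∧
  (∀ (pre : List (Gate N)) (g : Gate N) (post : List (Gate N)), C.gates = pre ++ g :: post →
    ∀ a ∈ g.op.args, a ∈ pre.map Gate.label) ∧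
  ∀ a ∈ C.outputs, a ∈ C.gates.map Gate.label

/-- The value at each gate label on input `x`, computed along the list of gates. -/
def values (C : Circuit N) (x : Fin N → Bool) : List Bool → Bool :=
  C.gates.foldl (fun v g => Function.update v g.label (g.op.eval x v)) fun _ => false

/-- The output string of the circuit on input `x`. -/
def eval (C : Circuit N) (x : Fin N → Bool) : List Bool :=
  C.outputs.map (C.values x)

/-- The depth of each gate label, computed along the list of gates. -/
def depths (C : Circuit N) : List Bool → ℕ :=
  C.gates.foldl (fun d g => Function.update d g.label (g.op.depth d)) fun _ => 0

/-- The depth of the deepest gate. -/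
def depth (C : Circuit N) : ℕ :=
  (C.gates.map fun g => C.depths g.label).foldr max 0

/-- The number of gates. -/
def size (C : Circuit N) : ℕ :=
  C.gates.length

end Circuit

/-! ### Descriptions of circuits as words over a finite alphabet -/

inductive CircuitSymbol : Type
  | bit (b : Bool)
  | input
  | not
  | and
  | or
  | comma
  | endGate
  | output

/-- Type of the gate, followed by the index of the input bit in binary (least significant bit
first), or by the labels of the gates that feed it. -/
def GateOp.encode {N : ℕ} : GateOp N → List CircuitSymbol
  | .input i => .input :: (Nat.bits i).map .bit
  | .not a => .not :: a.map .bit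
  | .and as => .and :: as.flatMap fun a => a.map .bit ++ [.comma]
  | .or as => .or :: as.flatMap fun a => a.map .bit ++ [.comma]

def Gate.encode {N : ℕ} (g : Gate N) : List CircuitSymbol :=
  g.label.map .bit ++ g.op.encode ++ [.endGate]

/-- The description of a circuit. -/
def Circuit.encode {N : ℕ} (C : Circuit N) : List CircuitSymbol :=
  C.gates.flatMap Gate.encode ++ C.outputs.flatMap fun a => .output :: a.map .bit

/-! ### Deterministic space-bounded Turing machines with output -/

/-- What the head on the read-only input tape can see. -/
inductive InputCell (I : Type) : Type
  | leftEnd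
  | symbol (a : I)
  | rightEnd

inductive HeadMove : Type
  | left
  | stay
  | right

/-- One-way infinite tape: a move to the left from cell `0` has no effect. -/
def HeadMove.apply : HeadMove → ℕ → ℕ
  | .left, p => p - 1
  | .stay, p => p
  | .right, p => p + 1

/-- A deterministic Turing machine with a read-only input tape over the alphabet `I`, finitely many
work tapes and a write-only output tape over the alphabet `O`. -/
structure Transducer (I O : Type) : Type 1 where
  /-- states -/
  Q : Type
  finiteQ : Finite Q
  /-- the initial state -/
  start : Q
  /-- work tapes -/
  K : Type
  finiteK : Finite K
  /-- alphabet of the work tapes -/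
  Γ : Type
  finiteΓ : Finite Γ
  blank : Γ
  /-- From the state, the visible input cell and the visible work cells: halt, or pass to a new
  state, move the input head, write on and move on each work tape, and append a word to the
  output. -/
  δ : Q → InputCell I → (K → Γ) → Option (Q × HeadMove × (K → Γ × HeadMove) × List O)

namespace Transducer

variable {I O : Type} (M : Transducer I O)

structure Config where
  state : M.Q
  inputPos : ℕ
  cells : M.K → ℕ → M.Γ
  heads : M.K → ℕ
  output : List O

/-- The input word `w` stands in the cells `1, …, |w|`, between the end markers in the cells `0`
and `|w| + 1`. -/
def readInput (w : List I) : ℕ → InputCell I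
  | 0 => .leftEnd
  | p + 1 => (w[p]?).elim .rightEnd .symbol

def init : M.Config where
  state := M.start
  inputPos := 0
  cells := fun _ _ => M.blank
  heads := fun _ => 0
  output := []

/-- One step on input `w`; `none` if the machine halts. The input head does not pass the right end
marker. -/
def step (w : List I) (c : M.Config) : Option M.Config :=
  (M.δ c.state (readInput w c.inputPos) fun t => c.cells t (c.heads t)).map fun r =>
    { state := r.1
      inputPos := min (r.2.1.apply c.inputPos) (w.length + 1)
      cells := fun t => Function.update (c.cells t) (c.heads t) (r.2.2.1 t).1
      heads := fun t => (r.2.2.1 t).2.apply (c.heads t)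
      output := c.output ++ r.2.2.2 }

/-- On input `w` the machine halts with output `out`, and it visits only the first `s` cells of
each work tape. -/
def OutputsInSpace (w : List I) (out : List O) (s : ℕ) : Prop :=
  (∃ c, StateTransition.Reaches (M.step w) M.init c ∧ M.step w c = none ∧ c.output = out) ∧
  ∀ c, StateTransition.Reaches (M.step w) M.init c → ∀ t, c.heads t < s

end Transducer

/-! ### Logspace-uniform `AC⁰` -/

/-- Some deterministic logspace Turing machine computes the map `1^N ↦ ⟨C_N⟩`. -/
def LogspaceUniform (C : (N : ℕ) → Circuit N) : Prop :=
  ∃ (M : Transducer Unit CircuitSymbol) (k : ℕ), ∀ N : ℕ,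
    M.OutputsInSpace (List.replicate N ()) (C N).encode (k * (Nat.log 2 N + 1))

/-- `C` is a logspace-uniform family of circuits over unbounded fan-in AND and OR gates and NOT
gates, of constant depth and polynomial size. -/
def IsUniformAC0 (C : (N : ℕ) → Circuit N) : Prop :=
  (∀ N, (C N).WellFormed) ∧
  (∃ d : ℕ, ∀ N, (C N).depth ≤ d) ∧
  (∃ k : ℕ, ∀ N, (C N).size ≤ N ^ k + k) ∧
  LogspaceUniform C

/-! ### Input and output strings -/

open Classical in
/-- The adjacency matrix of a graph on `{0, …, m-1}` as a string of `m²` bits, row by row. -/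
noncomputable def adjacencyString {m : ℕ} (G : SimpleGraph (Fin m)) : Fin (m * m) → Bool :=
  fun i => decide (G.Adj (finProdFinEquiv.symm i).1 (finProdFinEquiv.symm i).2)

/-- The `len` lowest binary digits of `a`, least significant digit first. -/
def binaryDigits (len a : ℕ) : List Bool :=
  (List.range len).map fun b => a.testBit b

open Classical in
/-- The string for a Latin square indexed by a subset `S` of `{0, …, m-1}`: the `m` bits of the
characteristic function of `S`, and then, for the pairs `(u, w)` row by row, the entry in row `u`
and column `w` as a binary number of `⌈log₂ m⌉` digits (all digits are `0` unless
`u, w ∈ S`). -/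
noncomputable def latinSquareString {m : ℕ} (S : Finset (Fin m)) (L : S → S → S) : List Bool :=
  (List.finRange m).map (fun u => decide (u ∈ S)) ++
  (List.finRange m).flatMap fun u => (List.finRange m).flatMap fun w =>
    binaryDigits (Nat.clog 2 m)
      (if h : u ∈ S ∧ w ∈ S then ((L ⟨u, h.1⟩ ⟨w, h.2⟩ : Fin m) : ℕ) else 0)

/-!
A Latin square graph is a 3-net: its points have three coordinates, two points are joined when they
agree in one of them, and any two coordinates identify the points with the pairs of symbols. Three
pairwise adjacent points are either collinear, and then share `n - 3` further common neighbours on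
their line, or form a triangle with at most one further common neighbour. For `n ≥ 5` collinearity,
hence parallelism, hence the Latin square read off from three base points, is therefore definable by
first-order formulas in the adjacency relation; the numerical order of the vertices selects a least
choice of base points, and bit predicates turn entries into digits.

A first-order formula becomes a circuit of constant depth with one gate for every subformula and
every assignment of the variables. A machine whose tape holds a bounded number of counters of
`O(log N)` digits prints these gates by nested loops. For `n ≤ 4` there are only finitely many
graphs, so any recovery is definable, and the machine prints those finitely many circuits from its
finite control.
-/

/-! ### Latin square graphs as nets -/

section Net

variable {V Q : Type*}

/-- A 3-net on the points `V`: three coordinates, any two of which identify the points with the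
pairs of elements of `Q`, such that `G` joins the different points that agree in a coordinate. It is
a Latin square graph with the three coordinates made explicit, up to the choice of labels. -/
structure IsNet (G : SimpleGraph V) (a b c : V → Q) : Prop where
  adj_iff : ∀ p q, G.Adj p q ↔ p ≠ q ∧ (a p = a q ∨ b p = b q ∨ c p = c q)
  bijective_ab : Function.Bijective fun p => (a p, b p)
  bijective_bc : Function.Bijective fun p => (b p, c p)
  bijective_ca : Function.Bijective fun p => (c p, a p)

theorem isNet_latinSquareGraph {Q : Type} {L : Q → Q → Q} (hL : IsLatinSquare L) :
    IsNet (latinSquareGraph L) (fun t => t.1.1) (fun t => t.1.2.1) fun t => t.1.2.2 where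
  adj_iff _ _ := Iff.rfl
  bijective_ab := by
    refine ⟨?_, fun ⟨x, y⟩ => ⟨⟨(x, y, L x y), rfl⟩, rfl⟩⟩
    rintro ⟨⟨x, y, z⟩, h⟩ ⟨⟨x', y', z'⟩, h'⟩ e
    obtain ⟨rfl, rfl⟩ := Prod.mk.inj e
    exact Subtype.ext (congrArg (x, y, ·) (h.symm.trans h'))
  bijective_bc := by
    refine ⟨?_, fun ⟨y, z⟩ => (hL.2 y).2 z |>.elim fun x h => ⟨⟨(x, y, z), h⟩, rfl⟩⟩
    rintro ⟨⟨x, y, z⟩, h⟩ ⟨⟨x', y', z'⟩, h'⟩ e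
    obtain ⟨rfl, rfl⟩ := Prod.mk.inj e
    exact Subtype.ext (congrArg (·, y, z) ((hL.2 y).1 (h.trans h'.symm)))
  bijective_ca := by
    refine ⟨?_, fun ⟨z, x⟩ => (hL.1 x).2 z |>.elim fun y h => ⟨⟨(x, y, z), h⟩, rfl⟩⟩
    rintro ⟨⟨x, y, z⟩, h⟩ ⟨⟨x', y', z'⟩, h'⟩ e
    obtain ⟨rfl, rfl⟩ := Prod.mk.inj e
    exact Subtype.ext (congrArg (x, ·, z) ((hL.1 x).1 (h.trans h'.symm)))

namespace IsNet

variable {G : SimpleGraph V} {a b c : V → Q}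

theorem comap_iso {W : Type*} {H : SimpleGraph W} {a b c : W → Q} (h : IsNet H a b c)
    (e : G ≃g H) : IsNet G (a ∘ e) (b ∘ e) (c ∘ e) where
  adj_iff p q := by rw [← e.map_adj_iff, h.adj_iff, e.injective.ne_iff]; rfl
  bijective_ab := h.bijective_ab.comp e.bijective
  bijective_bc := h.bijective_bc.comp e.bijective
  bijective_ca := h.bijective_ca.comp e.bijective

theorem rotate (h : IsNet G a b c) : IsNet G b c a where
  adj_iff p q := by rw [h.adj_iff]; tauto
  bijective_ab := h.bijective_bc
  bijective_bc := h.bijective_ca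
  bijective_ca := h.bijective_ab

theorem swap (h : IsNet G a b c) : IsNet G b a c where
  adj_iff p q := by rw [h.adj_iff]; tauto
  bijective_ab := Prod.swap_bijective.comp h.bijective_ab
  bijective_bc := Prod.swap_bijective.comp h.bijective_ca
  bijective_ca := Prod.swap_bijective.comp h.bijective_bc

theorem swapRight (h : IsNet G a b c) : IsNet G a c b :=
  h.rotate.rotate.swap

theorem ext (h : IsNet G a b c) {p q : V} (ha : a p = a q) (hb : b p = b q) : p = q :=
  h.bijective_ab.1 (Prod.ext ha hb)

theorem exists_point (h : IsNet G a b c) (s t : Q) : ∃ p, a p = s ∧ b p = t :=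
  (h.bijective_ab.2 (s, t)).imp fun _ hp => Prod.ext_iff.1 hp

theorem adj_of_eq (h : IsNet G a b c) {p q : V} (ha : a p = a q) (hne : p ≠ q) : G.Adj p q :=
  (h.adj_iff p q).2 ⟨hne, Or.inl ha⟩

theorem eq_or_eq_of_adj (h : IsNet G a b c) {p q : V} (hpq : G.Adj p q) (ha : a p ≠ a q) :
    b p = b q ∨ c p = c q :=
  ((h.adj_iff p q).1 hpq).2.resolve_left ha

theorem exists_adj_ne [Nontrivial Q] (h : IsNet G a b c) (p : V) :
    ∃ w, G.Adj p w ∧ a p ≠ a w := by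
  obtain ⟨t, ht⟩ := exists_ne (a p)
  obtain ⟨w, rfl, hwb⟩ := h.exists_point t (b p)
  exact ⟨w, h.rotate.adj_of_eq hwb.symm (ne_of_apply_ne a ht.symm), ht.symm⟩

theorem exists_isNet_eq (h : IsNet G a b c) {p q : V} (hpq : G.Adj p q) :
    ∃ a b c : V → Q, IsNet G a b c ∧ a p = a q := by
  rcases ((h.adj_iff p q).1 hpq).2 with ha | hb | hc
  · exact ⟨a, b, c, h, ha⟩
  · exact ⟨b, c, a, h.rotate, hb⟩
  · exact ⟨c, a, b, h.rotate.rotate, hc⟩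

section LatinSquare

variable {S : Type} {α β γ : S ≃ Q} {L : S → S → S}

theorem isLatinSquare (h : IsNet G a b c)
    (hL : ∀ x y z, L x y = z ↔ ∃ p, a p = α x ∧ b p = β y ∧ c p = γ z) : IsLatinSquare L := by
  refine ⟨fun x => ⟨fun y y' e => ?_, fun z => ?_⟩, fun y => ⟨fun x x' e => ?_, fun z => ?_⟩⟩
  · obtain ⟨p, hpa, hpb, hpc⟩ := (hL x y _).1 rfl
    obtain ⟨q, hqa, hqb, hqc⟩ := (hL x y' _).1 e.symm
    obtain rfl := h.swapRight.ext (hpa.trans hqa.symm) (hpc.trans hqc.symm)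
    exact β.injective (hpb.symm.trans hqb)
  · obtain ⟨p, hpa, hpc⟩ := h.swapRight.exists_point (α x) (γ z)
    exact ⟨β.symm (b p), (hL _ _ _).2 ⟨p, hpa, (β.apply_symm_apply _).symm, hpc⟩⟩
  · obtain ⟨p, hpa, hpb, hpc⟩ := (hL x y _).1 rfl
    obtain ⟨q, hqa, hqb, hqc⟩ := (hL x' y _).1 e.symm
    obtain rfl := h.rotate.ext (hpb.trans hqb.symm) (hpc.trans hqc.symm)
    exact α.injective (hpa.symm.trans hqa)
  · obtain ⟨p, hpb, hpc⟩ := h.rotate.exists_point (β y) (γ z)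
    exact ⟨α.symm (a p), (hL _ _ _).2 ⟨p, (α.apply_symm_apply _).symm, hpb, hpc⟩⟩

theorem nonempty_iso_latinSquareGraph (h : IsNet G a b c)
    (hL : ∀ x y z, L x y = z ↔ ∃ p, a p = α x ∧ b p = β y ∧ c p = γ z) :
    Nonempty (G ≃g latinSquareGraph L) := by
  let f (p : V) : {t : S × S × S // L t.1 t.2.1 = t.2.2} :=
    ⟨(α.symm (a p), β.symm (b p), γ.symm (c p)), (hL _ _ _).2 ⟨p, by simp⟩⟩
  have hf : Function.Bijective f := by
    constructor
    · intro p q e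
      obtain ⟨ha, hb, -⟩ : a p = a q ∧ b p = b q ∧ c p = c q := by simpa [f] using e
      exact h.ext ha hb
    · rintro ⟨⟨x, y, z⟩, e⟩
      obtain ⟨p, hx, hy, hz⟩ := (hL _ _ _).1 e
      exact ⟨p, by simp [f, hx, hy, hz]⟩
  refine ⟨Equiv.ofBijective f hf, fun {p q} => ?_⟩
  rw [h.adj_iff]
  exact and_congr hf.1.ne_iff (or_congr α.symm.injective.eq_iff
    (or_congr β.symm.injective.eq_iff γ.symm.injective.eq_iff))

theorem exists_latinSquare (h : IsNet G a b c) (α β γ : S ≃ Q) :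
    ∃ L : S → S → S, IsLatinSquare L ∧ Nonempty (G ≃g latinSquareGraph L) ∧
      ∀ x y z, L x y = z ↔ ∃ p, a p = α x ∧ b p = β y ∧ c p = γ z := by
  choose f hfa hfb using h.exists_point
  have hL : ∀ x y z, γ.symm (c (f (α x) (β y))) = z ↔
      ∃ p, a p = α x ∧ b p = β y ∧ c p = γ z := by
    intro x y z
    rw [Equiv.symm_apply_eq]
    refine ⟨fun e => ⟨_, hfa _ _, hfb _ _, e⟩, ?_⟩
    rintro ⟨p, hpa, hpb, hpc⟩
    rw [h.ext ((hfa _ _).trans hpa.symm) ((hfb _ _).trans hpb.symm), hpc]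
  exact ⟨_, h.isLatinSquare hL, h.nonempty_iso_latinSquareGraph hL, hL⟩

end LatinSquare

end IsNet

/-! ### Lines and parallel classes in terms of adjacency -/

/-- The point `w` lies on the line through the adjacent points `p` and `q`: three pairwise adjacent
points have two further common neighbours if and only if they are collinear, provided that lines
have at least five points. -/
def OnLine (A : V → V → Prop) (p q w : V) : Prop :=
  (w = p ∨ w = q) ∨ (A w p ∧ A w q) ∧ ∃ s t, s ≠ t ∧
    (A s p ∧ A s q ∧ A s w) ∧ (A t p ∧ A t q ∧ A t w)

/-- The points `p` and `q` are equal, or joined by a line parallel to the one through `o` and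
`u`. -/
def SameClass (A : V → V → Prop) (o u p q : V) : Prop :=
  p = q ∨ A p q ∧ ((OnLine A p q o ∧ OnLine A p q u) ∨ ¬ ∃ w, OnLine A o u w ∧ OnLine A p q w)

/-- The points `p` and `q` are equal, or joined by a line that is parallel neither to the one
through `o` and `u` nor to the one through `o` and `v`. -/
def ThirdClass (A : V → V → Prop) (o u v p q : V) : Prop :=
  p = q ∨ A p q ∧ ¬ SameClass A o u p q ∧ ¬ SameClass A o v p q

/-- The entry of the recovered Latin square in row `x` and column `y` is `z`. Rows, columns and
symbols are named after the points of the line through `o` and `u`: a point names the column and the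
symbol that pass through it, and it names the row through that point `s` of the line through `o` and
`v` which has the same symbol. -/
def Entry (A : V → V → Prop) (o u v x y z : V) : Prop :=
  (SameClass A o u o x ∧ SameClass A o u o y ∧ SameClass A o u o z) ∧
    ∃ p s, (SameClass A o v o s ∧ ThirdClass A o u v x s) ∧ SameClass A o u s p ∧
      SameClass A o v p y ∧ ThirdClass A o u v p z

namespace IsNet

variable {G : SimpleGraph V} {a b c : V → Q}

theorem coords_of_adj_of_adj (h : IsNet G a b c) {p q x : V} (hpq : G.Adj p q) (ha : a p = a q)
    (hxp : G.Adj x p) (hxq : G.Adj x q) (hx : a x ≠ a p) :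
    (b x = b p ∧ c x = c q) ∨ (b x = b q ∧ c x = c p) := by
  rcases h.eq_or_eq_of_adj hxp hx with hp | hp <;>
    rcases h.eq_or_eq_of_adj hxq (ha ▸ hx) with hq | hq
  · exact absurd (h.ext ha (hp.symm.trans hq)) hpq.ne
  · exact Or.inl ⟨hp, hq⟩
  · exact Or.inr ⟨hq, hp⟩
  · exact absurd (h.swapRight.ext ha (hp.symm.trans hq)) hpq.ne

theorem coords_of_adj_of_adj_of_adj (h : IsNet G a b c) {p q w x : V} (hpq : G.Adj p q)
    (ha : a p = a q) (hw : a w ≠ a p) (hwb : b w = b p) (hwc : c w = c q) (hxp : G.Adj x p)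
    (hxq : G.Adj x q) (hxw : G.Adj x w) : b x = b q ∧ c x = c p := by
  have hx : a x ≠ a p := by
    intro hx
    rcases h.eq_or_eq_of_adj hxw (hx.trans_ne hw.symm) with hb | hc
    · exact hxp.ne (h.ext hx (hb.trans hwb))
    · exact hxq.ne (h.swapRight.ext (hx.trans ha) (hc.trans hwc))
  refine (h.coords_of_adj_of_adj hpq ha hxp hxq hx).resolve_left fun ⟨hb, hc⟩ => hxw.ne ?_
  exact h.rotate.ext (hb.trans hwb.symm) (hc.trans hwc.symm)

theorem eq_of_onLine (h : IsNet G a b c) {p q w : V} (hpq : G.Adj p q) (ha : a p = a q)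
    (hw : OnLine G.Adj p q w) : a w = a p := by
  obtain (rfl | rfl) | ⟨⟨hwp, hwq⟩, s, t, hst, ⟨hsp, hsq, hsw⟩, htp, htq, htw⟩ := hw
  · rfl
  · exact ha.symm
  · by_contra hne
    refine hst ?_
    rcases h.coords_of_adj_of_adj hpq ha hwp hwq hne with ⟨hb, hc⟩ | ⟨hb, hc⟩
    · obtain ⟨hsb, hsc⟩ := h.coords_of_adj_of_adj_of_adj hpq ha hne hb hc hsp hsq hsw
      obtain ⟨htb, htc⟩ := h.coords_of_adj_of_adj_of_adj hpq ha hne hb hc htp htq htw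
      exact h.rotate.ext (hsb.trans htb.symm) (hsc.trans htc.symm)
    · have hne' : a w ≠ a q := ha ▸ hne
      obtain ⟨hsb, hsc⟩ :=
        h.coords_of_adj_of_adj_of_adj hpq.symm ha.symm hne' hb hc hsq hsp hsw
      obtain ⟨htb, htc⟩ :=
        h.coords_of_adj_of_adj_of_adj hpq.symm ha.symm hne' hb hc htq htp htw
      exact h.rotate.ext (hsb.trans htb.symm) (hsc.trans htc.symm)

theorem exists_two_points_of_card_add_two_le [Finite Q] (h : IsNet G a b c) (x : Q) (T : Finset Q)
    (hT : T.card + 2 ≤ Nat.card Q) :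
    ∃ s t, s ≠ t ∧ (a s = x ∧ b s ∉ T) ∧ (a t = x ∧ b t ∉ T) := by
  classical
  have := Fintype.ofFinite Q
  have hcard : 1 < Tᶜ.card := by
    rw [Finset.card_compl, ← Nat.card_eq_fintype_card]
    omega
  obtain ⟨y, hy, z, hz, hyz⟩ := Finset.one_lt_card.1 hcard
  obtain ⟨s, hsa, rfl⟩ := h.exists_point x y
  obtain ⟨t, hta, rfl⟩ := h.exists_point x z
  exact ⟨s, t, fun hst => hyz (congrArg b hst), ⟨hsa, Finset.mem_compl.1 hy⟩, hta,
    Finset.mem_compl.1 hz⟩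

theorem onLine_of_eq [Finite Q] (hQ : 5 ≤ Nat.card Q) (h : IsNet G a b c) {p q w : V}
    (ha : a p = a q) (hw : a w = a p) : OnLine G.Adj p q w := by
  classical
  by_cases hwp : w = p
  · exact Or.inl (Or.inl hwp)
  by_cases hwq : w = q
  · exact Or.inl (Or.inr hwq)
  obtain ⟨s, t, hst, ⟨hsa, hsb⟩, hta, htb⟩ :=
    h.exists_two_points_of_card_add_two_le (a p) {b p, b q, b w}
      ((Nat.add_le_add_right Finset.card_le_three 2).trans hQ)
  have adj_of_notMem {x : V} (hxa : a x = a p) (hxb : b x ∉ ({b p, b q, b w} : Finset Q)) :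
      G.Adj x p ∧ G.Adj x q ∧ G.Adj x w := by
    simp only [Finset.mem_insert, Finset.mem_singleton, not_or] at hxb
    exact ⟨h.adj_of_eq hxa (ne_of_apply_ne b hxb.1),
      h.adj_of_eq (hxa.trans ha) (ne_of_apply_ne b hxb.2.1),
      h.adj_of_eq (hxa.trans hw.symm) (ne_of_apply_ne b hxb.2.2)⟩
  exact Or.inr ⟨⟨h.adj_of_eq hw hwp, h.adj_of_eq (hw.trans ha) hwq⟩, s, t, hst,
    adj_of_notMem hsa hsb, adj_of_notMem hta htb⟩

theorem onLine_iff [Finite Q] (hQ : 5 ≤ Nat.card Q) (h : IsNet G a b c) {p q : V}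
    (hpq : G.Adj p q) (ha : a p = a q) (w : V) : OnLine G.Adj p q w ↔ a w = a p :=
  ⟨h.eq_of_onLine hpq ha, h.onLine_of_eq hQ ha⟩

theorem not_sameClass_of_transversal [Finite Q] (hQ : 5 ≤ Nat.card Q) (h : IsNet G a b c)
    {o u p q : V} (hou : G.Adj o u) (ho : a o = a u) (hpq : G.Adj p q) (hb : b p = b q) :
    ¬ SameClass G.Adj o u p q := by
  simp only [SameClass, hpq.ne, hpq, false_or, true_and, h.onLine_iff hQ hou ho,
    h.swap.onLine_iff hQ hpq hb]
  rintro (⟨hop, hup⟩ | hdisj)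
  · exact hou.ne (h.ext ho (hop.trans hup.symm))
  · exact hdisj (h.exists_point (a o) (b p))

theorem sameClass_iff [Finite Q] (hQ : 5 ≤ Nat.card Q) (h : IsNet G a b c) {o u : V}
    (hou : G.Adj o u) (ho : a o = a u) (p q : V) : SameClass G.Adj o u p q ↔ a p = a q := by
  constructor
  · rintro hpq
    obtain rfl | hadj := hpq.imp_right And.left
    · rfl
    by_contra ha
    rcases h.eq_or_eq_of_adj hadj ha with hb | hc
    · exact h.not_sameClass_of_transversal hQ hou ho hadj hb hpq
    · exact h.swapRight.not_sameClass_of_transversal hQ hou ho hadj hc hpq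
  · intro ha
    refine or_iff_not_imp_left.2 fun hne => ⟨h.adj_of_eq ha hne, ?_⟩
    simp only [h.onLine_iff hQ hou ho, h.onLine_iff hQ (h.adj_of_eq ha hne) ha]
    by_cases hop : a o = a p
    · exact Or.inl ⟨hop, ho ▸ hop⟩
    · exact Or.inr fun ⟨w, hwo, hwp⟩ => hop (hwo.symm.trans hwp)

theorem thirdClass_iff [Finite Q] (hQ : 5 ≤ Nat.card Q) (h : IsNet G a b c) {o u v : V}
    (hou : G.Adj o u) (hu : a o = a u) (hov : G.Adj o v) (hv : b o = b v) (p q : V) :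
    ThirdClass G.Adj o u v p q ↔ c p = c q := by
  rw [ThirdClass, h.sameClass_iff hQ hou hu, h.swap.sameClass_iff hQ hov hv]
  constructor
  · rintro (rfl | ⟨hadj, ha, hb⟩)
    · rfl
    · exact (h.eq_or_eq_of_adj hadj ha).resolve_left hb
  · refine fun hc => or_iff_not_imp_left.2 fun hne => ⟨h.rotate.rotate.adj_of_eq hc hne, ?_, ?_⟩
    · exact fun ha => hne (h.swapRight.ext ha hc)
    · exact fun hb => hne (h.rotate.ext hb hc)

theorem entry_iff [Finite Q] (hQ : 5 ≤ Nat.card Q) (h : IsNet G a b c) {o u v : V}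
    (hou : G.Adj o u) (hu : a o = a u) (hov : G.Adj o v) (hv : b o = b v) (x y z : V) :
    Entry G.Adj o u v x y z ↔ (a o = a x ∧ a o = a y ∧ a o = a z) ∧
      ∃ p s, (b o = b s ∧ c x = c s) ∧ a s = a p ∧ b p = b y ∧ c p = c z := by
  simp only [Entry, h.sameClass_iff hQ hou hu, h.swap.sameClass_iff hQ hov hv,
    h.thirdClass_iff hQ hou hu hov hv]

/-- The points of a line are identified with the second coordinates. -/
noncomputable def lineEquiv (h : IsNet G a b c) (o : V) {P : V → Prop}
    (hP : ∀ x, P x ↔ a o = a x) : {x // P x} ≃ Q :=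
  Equiv.ofBijective (fun x => b x.1)
    ⟨fun x y e => Subtype.ext (h.ext (((hP _).1 x.2).symm.trans ((hP _).1 y.2)) e), fun t =>
      let ⟨p, hpa, hpb⟩ := h.exists_point (a o) t
      ⟨⟨p, (hP _).2 hpa.symm⟩, hpb⟩⟩

theorem isNClique [Fintype Q] (h : IsNet G a b c) (o : V) {S : Finset V}
    (hS : ∀ x, x ∈ S ↔ a o = a x) : G.IsNClique (Fintype.card Q) S := by
  refine ⟨fun x hx y hy => h.adj_of_eq (((hS x).1 hx).symm.trans ((hS y).1 hy)), ?_⟩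
  rw [← Fintype.card_coe]
  exact Fintype.card_congr (h.lineEquiv o hS)

/-- The row through the point `s` of the line `b o = b s` that has the same symbol as the given
point. -/
noncomputable def rowEquiv (h : IsNet G a b c) (o : V) {P : V → Prop}
    (hP : ∀ x, P x ↔ a o = a x) : {x // P x} ≃ Q :=
  (h.swapRight.lineEquiv o hP).trans
    ((h.rotate.lineEquiv o fun _ => Iff.rfl).symm.trans (h.swap.lineEquiv o fun _ => Iff.rfl))

theorem rowEquiv_apply (h : IsNet G a b c) {o s : V} {P : V → Prop}
    (hP : ∀ x, P x ↔ a o = a x) (x : {x // P x}) (hb : b o = b s) (hc : c x = c s) :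
    h.rowEquiv o hP x = a s := by
  have : (h.rotate.lineEquiv o fun _ => Iff.rfl).symm (h.swapRight.lineEquiv o hP x) = ⟨s, hb⟩ :=
    (Equiv.symm_apply_eq _).2 hc
  exact congrArg (h.swap.lineEquiv o fun _ => Iff.rfl) this

theorem exists_latinSquare_entry {V : Type} {G : SimpleGraph V} {a b c : V → Q} [Finite Q]
    (hQ : 5 ≤ Nat.card Q) (h : IsNet G a b c) {o u v : V} (hou : G.Adj o u) (hu : a o = a u)
    (hov : G.Adj o v) (hv : b o = b v) {P : V → Prop} (hP : ∀ x, P x ↔ a o = a x) :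
    ∃ L : {x // P x} → {x // P x} → {x // P x}, IsLatinSquare L ∧
      Nonempty (G ≃g latinSquareGraph L) ∧
      ∀ x y z, Entry G.Adj o u v x y z ↔
        ∃ (hx : P x) (hy : P y), (L ⟨x, hx⟩ ⟨y, hy⟩ : V) = z := by
  obtain ⟨L, hL, hiso, hLp⟩ := h.exists_latinSquare (h.rowEquiv o hP) (h.lineEquiv o hP)
    (h.swapRight.lineEquiv o hP)
  refine ⟨L, hL, hiso, fun x y z => ?_⟩
  rw [h.entry_iff hQ hou hu hov hv]
  constructor
  · rintro ⟨⟨hx, hy, hz⟩, p, s, ⟨hsb, hsc⟩, hpa, hpb, hpc⟩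
    refine ⟨(hP x).2 hx, (hP y).2 hy, congrArg Subtype.val ((hLp _ _ ⟨z, (hP z).2 hz⟩).2 ?_)⟩
    exact ⟨p, hpa.symm.trans (h.rowEquiv_apply hP ⟨x, _⟩ hsb hsc).symm, hpb, hpc⟩
  · rintro ⟨hx, hy, rfl⟩
    obtain ⟨p, hpa, hpb, hpc⟩ := (hLp ⟨x, hx⟩ ⟨y, hy⟩ _).1 rfl
    obtain ⟨s, hsb, hsc⟩ := h.rotate.exists_point (b o) (c x)
    exact ⟨⟨(hP x).1 hx, (hP y).1 hy, (hP _).1 (L _ _).2⟩, p, s, ⟨hsb.symm, hsc.symm⟩,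
      (hpa.trans (h.rowEquiv_apply hP ⟨x, hx⟩ hsb.symm hsc.symm)).symm, hpb, hpc⟩

end IsNet

end Net

/-! ### First-order formulas over graphs with numerical predicates -/

/-- First-order formulas in the variables `0, …, c - 1` over graphs on `{0, …, m-1}`, with arbitrary
predicates of the numerical values of the variables. -/
inductive Formula (c : ℕ) : Type
  | adj (x y : Fin c)
  | num (p : (Fin c → ℕ) → Bool)
  | not (φ : Formula c)
  | and (φ ψ : Formula c)
  | ex (x : Fin c) (φ : Formula c)

namespace Formula

variable {c : ℕ}

/-- The truth value of a formula over the relation `A` under an assignment. -/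
def eval {m : ℕ} (A : Fin m → Fin m → Prop) : Formula c → (Fin c → Fin m) → Prop
  | adj x y, a => A (a x) (a y)
  | num p, a => p (fun x => a x) = true
  | not φ, a => ¬ φ.eval A a
  | and φ ψ, a => φ.eval A a ∧ ψ.eval A a
  | ex x φ, a => ∃ i, φ.eval A (Function.update a x i)

/-- Disjunction, by De Morgan's law. -/
def or (φ ψ : Formula c) : Formula c := not (and (not φ) (not ψ))

/-- Logical equivalence. -/
def iff (φ ψ : Formula c) : Formula c := or (and φ ψ) (not (or φ ψ))

/-- The disjunction of a list of formulas. -/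
def any : List (Formula c) → Formula c
  | [] => num fun _ => false
  | φ :: l => or φ (any l)

/-- Equality of two variables, as a numerical predicate. -/
def eq (x y : Fin c) : Formula c := num fun a => decide (a x = a y)

/-- Comparison of two variables, as a numerical predicate. -/
def lt (x y : Fin c) : Formula c := num fun a => decide (a x < a y)

/-- The numbers `x` and `y` have a common binary digit `1`. If `y` is a power of two, this is the
bit predicate. -/
def meet (x y : Fin c) : Formula c := num fun a => decide (a x &&& a y ≠ 0)

open Classical in
/-- A relation on `{0, …, m-1}`, as a numerical predicate. -/
noncomputable def ofRel {m : ℕ} (R : (Fin c → Fin m) → Prop) : Formula c :=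
  num fun a => decide (∃ h : ∀ x, a x < m, R fun x => ⟨a x, h x⟩)

/-- The adjacency relation is that of `G`. The variables `x` and `y` are bound. -/
noncomputable def isGraph {m : ℕ} (G : SimpleGraph (Fin m)) (x y : Fin c) : Formula c :=
  let edge : Formula c := ofRel fun a => G.Adj (a x) (a y)
  not (ex x (ex y (not (iff (adj x y) edge))))

section Eval

variable {m : ℕ} {A : Fin m → Fin m → Prop} {a : Fin c → Fin m} {x y : Fin c} {φ ψ : Formula c}

@[simp] theorem eval_adj : (adj x y).eval A a ↔ A (a x) (a y) := Iff.rfl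

@[simp] theorem eval_num {p : (Fin c → ℕ) → Bool} :
    (num p).eval A a ↔ p (fun x => a x) = true := Iff.rfl

@[simp] theorem eval_not : φ.not.eval A a ↔ ¬ φ.eval A a := Iff.rfl

@[simp] theorem eval_and : (φ.and ψ).eval A a ↔ φ.eval A a ∧ ψ.eval A a := Iff.rfl

@[simp] theorem eval_ex : (ex x φ).eval A a ↔ ∃ i, φ.eval A (Function.update a x i) := Iff.rfl

@[simp] theorem eval_or : (φ.or ψ).eval A a ↔ φ.eval A a ∨ ψ.eval A a := by
  simp only [or, eval_not, eval_and, or_iff_not_and_not]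

@[simp] theorem eval_iff : (φ.iff ψ).eval A a ↔ (φ.eval A a ↔ ψ.eval A a) := by
  simp only [iff, eval_or, eval_and, eval_not]
  tauto

@[simp] theorem eval_any {l : List (Formula c)} : (any l).eval A a ↔ ∃ φ ∈ l, φ.eval A a := by
  induction l with
  | nil => simp [any]
  | cons φ l ih => simp [any, ih]

@[simp] theorem eval_eq : (eq x y).eval A a ↔ a x = a y := by
  simp [eq, Fin.ext_iff]

@[simp] theorem eval_lt : (lt x y).eval A a ↔ a x < a y := by
  simp [lt]

@[simp] theorem eval_meet : (meet x y).eval A a ↔ (a x : ℕ) &&& (a y : ℕ) ≠ 0 := by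
  simp [meet]

@[simp] theorem eval_ofRel {R : (Fin c → Fin m) → Prop} : (ofRel R).eval A a ↔ R a := by
  simp [ofRel]

theorem eval_isGraph {G H : SimpleGraph (Fin m)} (hxy : x ≠ y) :
    (isGraph G x y).eval H.Adj a ↔ H = G := by
  simp [isGraph, hxy, SimpleGraph.ext_iff, funext_iff]

end Eval

/-- With finitely many graphs, the formula is a disjunction that identifies `G` by its adjacency
relation and then uses `R G` as a numerical predicate. -/
theorem exists_eval_iff {m : ℕ} (hc : 2 ≤ c)
    (R : SimpleGraph (Fin m) → (Fin c → Fin m) → Prop) :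
    ∃ φ : Formula c, ∀ G a, φ.eval G.Adj a ↔ R G a := by
  classical
  have : Nontrivial (Fin c) := Fin.nontrivial_iff_two_le.2 hc
  obtain ⟨x, y, hxy⟩ := exists_pair_ne (Fin c)
  refine ⟨any ((Finset.univ : Finset (SimpleGraph (Fin m))).toList.map fun G =>
    and (isGraph G x y) (ofRel (R G))), fun G a => ?_⟩
  simp [eval_isGraph hxy]

end Formula

/-! ### Definability of the recovered Latin square -/

namespace LatinFormula

open Formula

/-- The formula for `OnLine`. The variables `11` and `12` are reserved for bound variables. -/
def onLine (p q w : Fin 13) : Formula 13 :=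
  or (or (eq w p) (eq w q)) (and (and (adj w p) (adj w q))
    (ex 11 (ex 12 (and (not (eq 11 12)) (and (and (adj 11 p) (and (adj 11 q) (adj 11 w)))
      (and (adj 12 p) (and (adj 12 q) (adj 12 w))))))))

/-- The formula for `SameClass`. The variable `10` is reserved for a bound variable. -/
def sameClass (o u p q : Fin 13) : Formula 13 :=
  or (eq p q) (and (adj p q) (or (and (onLine p q o) (onLine p q u))
    (not (ex 10 (and (onLine o u 10) (onLine p q 10))))))

/-- The formula for `ThirdClass`. -/
def thirdClass (o u v p q : Fin 13) : Formula 13 :=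
  or (eq p q) (and (adj p q) (and (not (sameClass o u p q)) (not (sameClass o v p q))))

/-- The formula for `Entry`. The variables `7` and `8` are reserved for bound variables. -/
def entry (o u v x y z : Fin 13) : Formula 13 :=
  and (and (sameClass o u o x) (and (sameClass o u o y) (sameClass o u o z)))
    (ex 7 (ex 8 (and (and (sameClass o v o 8) (thirdClass o u v x 8))
      (and (sameClass o u 8 7) (and (sameClass o v 7 y) (thirdClass o u v 7 z))))))

/-- The formula for `IsBase` of the variables `4` and `5`. -/
def base : Formula 13 :=
  and (not (ex 9 (lt 9 4))) (and (adj 4 5) (not (ex 9 (and (adj 4 9) (lt 9 5)))))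

/-- The formula for `IsSecond` of the variables `4`, `5` and `6`. -/
def second : Formula 13 :=
  and (and (adj 4 6) (not (sameClass 4 5 4 6)))
    (not (ex 9 (and (and (adj 4 9) (not (sameClass 4 5 4 9))) (lt 9 6))))

/-- The variable `0` belongs to the index set of the recovered Latin square. -/
def index : Formula 13 :=
  ex 4 (ex 5 (and base (sameClass 4 5 4 0)))

/-- The entry in row `0` and column `1` has a common binary digit `1` with the variable `2`. -/
def entryDigit : Formula 13 :=
  ex 4 (ex 5 (ex 6 (and (and base second) (ex 3 (and (entry 4 5 6 0 1 3) (meet 3 2))))))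

end LatinFormula

section Frame

variable {V : Type*} [LinearOrder V]

/-- The canonical choice of the first line: `o` is the first vertex, and `u` is its first
neighbour. -/
def IsBase (A : V → V → Prop) (o u : V) : Prop :=
  IsBot o ∧ IsLeast {w | A o w} u

/-- The canonical choice of the second line: `v` is the first neighbour of `o` that is not on the
line through `o` and `u`. -/
def IsSecond (A : V → V → Prop) (o u v : V) : Prop :=
  IsLeast {w | A o w ∧ ¬ SameClass A o u o w} v

variable {A : V → V → Prop} {o u v o' u' v' : V}

theorem IsBase.unique (h : IsBase A o u) (h' : IsBase A o' u') : o = o' ∧ u = u' := by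
  obtain rfl : o = o' := le_antisymm (h.1 _) (h'.1 _)
  exact ⟨rfl, h.2.unique h'.2⟩

theorem IsSecond.unique (h : IsSecond A o u v) (h' : IsSecond A o u v') : v = v' :=
  IsLeast.unique h h'

theorem exists_isLeast_of_nonempty [WellFoundedLT V] {s : Set V} (hs : s.Nonempty) :
    ∃ x, IsLeast s x :=
  ⟨wellFounded_lt.min s hs, wellFounded_lt.min_mem s hs, fun _ hx => wellFounded_lt.min_le hx⟩

namespace IsNet

variable {Q : Type*} {G : SimpleGraph V} {a b c : V → Q}

theorem exists_isBase [WellFoundedLT V] [Nonempty V] [Nontrivial Q] (h : IsNet G a b c) :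
    ∃ o u, IsBase G.Adj o u := by
  obtain ⟨o, -, ho⟩ := exists_isLeast_of_nonempty (Set.univ_nonempty (α := V))
  obtain ⟨u, hu⟩ := exists_isLeast_of_nonempty ((h.exists_adj_ne o).imp fun _ => And.left)
  exact ⟨o, u, fun w => ho (Set.mem_univ w), hu⟩

theorem exists_isSecond [WellFoundedLT V] [Finite Q] (hQ : 5 ≤ Nat.card Q) (h : IsNet G a b c)
    (hou : G.Adj o u) (ha : a o = a u) : ∃ v, IsSecond G.Adj o u v := by
  have : Nontrivial Q := Finite.one_lt_card_iff_nontrivial.1 (by omega)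
  obtain ⟨w, hw, haw⟩ := h.exists_adj_ne o
  exact exists_isLeast_of_nonempty ⟨w, hw, mt (h.sameClass_iff hQ hou ha o w).1 haw⟩

theorem exists_isNet_of_isSecond [Finite Q] (hQ : 5 ≤ Nat.card Q) (h : IsNet G a b c)
    (hou : G.Adj o u) (ha : a o = a u) (hv : IsSecond G.Adj o u v) :
    ∃ b c : V → Q, IsNet G a b c ∧ b o = b v := by
  obtain ⟨⟨hov, hav⟩, -⟩ := hv
  rw [h.sameClass_iff hQ hou ha] at hav
  rcases h.eq_or_eq_of_adj hov hav with hb | hc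
  · exact ⟨b, c, h, hb⟩
  · exact ⟨c, b, h.swapRight, hc⟩

end IsNet

end Frame

namespace LatinFormula

variable {m : ℕ} {A : Fin m → Fin m → Prop} {a : Fin 13 → Fin m} {o u v p q w x y z : Fin 13}

theorem eval_onLine (hp : p < 11) (hq : q < 11) (hw : w < 11) :
    (onLine p q w).eval A a ↔ OnLine A (a p) (a q) (a w) := by
  have h : (11 : Fin 13) < 12 := by decide
  simp [onLine, OnLine, hp.ne, hq.ne, hw.ne, (hp.trans h).ne, (hq.trans h).ne, (hw.trans h).ne,
    h.ne]

theorem eval_sameClass (ho : o < 10) (hu : u < 10) (hp : p < 10) (hq : q < 10) :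
    (sameClass o u p q).eval A a ↔ SameClass A (a o) (a u) (a p) (a q) := by
  have h : (10 : Fin 13) < 11 := by decide
  simp [sameClass, SameClass, eval_onLine, ho.trans h, hu.trans h, hp.trans h, hq.trans h, h, ho.ne,
    hu.ne, hp.ne, hq.ne]

theorem eval_thirdClass (ho : o < 10) (hu : u < 10) (hv : v < 10) (hp : p < 10) (hq : q < 10) :
    (thirdClass o u v p q).eval A a ↔ ThirdClass A (a o) (a u) (a v) (a p) (a q) := by
  simp [thirdClass, ThirdClass, eval_sameClass, ho, hu, hv, hp, hq]

theorem eval_entry (ho : o < 7) (hu : u < 7) (hv : v < 7) (hx : x < 7) (hy : y < 7) (hz : z < 7) :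
    (entry o u v x y z).eval A a ↔ Entry A (a o) (a u) (a v) (a x) (a y) (a z) := by
  have h : (7 : Fin 13) < 10 := by decide
  have h' : (8 : Fin 13) < 10 := by decide
  have h8 : (7 : Fin 13) < 8 := by decide
  simp [entry, Entry, eval_sameClass, eval_thirdClass, ho.trans h, hu.trans h, hv.trans h,
    hx.trans h, hy.trans h, hz.trans h, h, h', ho.ne, hu.ne, hv.ne, hx.ne, hy.ne, hz.ne,
    (ho.trans h8).ne, (hu.trans h8).ne, (hv.trans h8).ne, (hx.trans h8).ne, (hy.trans h8).ne,
    (hz.trans h8).ne, h8.ne]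

theorem eval_base : base.eval A a ↔ IsBase A (a 4) (a 5) := by
  simp [base, IsBase, IsBot, IsLeast, mem_lowerBounds]

theorem eval_second : second.eval A a ↔ IsSecond A (a 4) (a 5) (a 6) := by
  simp [second, IsSecond, eval_sameClass, IsLeast, mem_lowerBounds]

theorem eval_index : index.eval A a ↔ ∃ o u, IsBase A o u ∧ SameClass A o u o (a 0) := by
  simp [index, eval_base, eval_sameClass]

theorem eval_entryDigit : entryDigit.eval A a ↔ ∃ o u v, (IsBase A o u ∧ IsSecond A o u v) ∧
    ∃ z, Entry A o u v (a 0) (a 1) z ∧ (z : ℕ) &&& (a 2 : ℕ) ≠ 0 := by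
  simp [entryDigit, eval_base, eval_second, eval_entry]

end LatinFormula

section Recovery

/-- The Latin square `L` is recovered from `G`: its rows, columns and symbols are indexed by an
`n`-clique, and its graph is isomorphic to `G`. -/
def IsRecovery {V : Type} (n : ℕ) (G : SimpleGraph V) (S : Finset V) (L : S → S → S) : Prop :=
  G.IsNClique n S ∧ IsLatinSquare L ∧ Nonempty (G ≃g latinSquareGraph L)

/-- The entry of `L` in row `u` and column `w` has a common binary digit `1` with `k`. -/
def EntryMeets {m : ℕ} {S : Finset (Fin m)} (L : S → S → S) (u w : Fin m) (k : ℕ) : Prop :=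
  ∃ (hu : u ∈ S) (hw : w ∈ S), ((L ⟨u, hu⟩ ⟨w, hw⟩ : Fin m) : ℕ) &&& k ≠ 0

/-- On the graphs of Latin squares of order `n`, the formula `φ` in the variable `x` defines the
index set, and `ψ` in the variables `x`, `y`, `z` the digits of the entries, of a recovered Latin
square. -/
def Recovers {c : ℕ} (n : ℕ) (x y z : Fin c) (φ ψ : Formula c) : Prop :=
  ∀ L : Fin n → Fin n → Fin n, IsLatinSquare L → ∀ G : SimpleGraph (Fin (n ^ 2)),
    Nonempty (G ≃g latinSquareGraph L) → ∃ S L', IsRecovery n G S L' ∧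
      (∀ a, φ.eval G.Adj a ↔ a x ∈ S) ∧ ∀ a, ψ.eval G.Adj a ↔ EntryMeets L' (a x) (a y) (a z)

open LatinFormula in
theorem recovers_index_entryDigit {n : ℕ} (hn : 5 ≤ n) : Recovers n 0 1 2 index entryDigit := by
  classical
  rintro L hL G ⟨e⟩
  have hQ : 5 ≤ Nat.card (Fin n) := by rwa [Nat.card_fin]
  have : Nontrivial (Fin n) := Fin.nontrivial_iff_two_le.2 (by omega)
  have : NeZero (n ^ 2) := ⟨by positivity⟩
  have net := (isNet_latinSquareGraph hL).comap_iso e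
  obtain ⟨o, u, hbase⟩ := net.exists_isBase
  have hou : G.Adj o u := hbase.2.1
  obtain ⟨a, b, c, net, ha⟩ := net.exists_isNet_eq hou
  obtain ⟨v, hsecond⟩ := net.exists_isSecond hQ hou ha
  obtain ⟨b, c, net, hb⟩ := net.exists_isNet_of_isSecond hQ hou ha hsecond
  let S : Finset (Fin (n ^ 2)) := {x | a o = a x}
  have hS : ∀ x, x ∈ S ↔ a o = a x := by simp [S]
  obtain ⟨L', hL', hiso, hentry⟩ := net.exists_latinSquare_entry hQ hou ha hsecond.1.1 hb hS
  refine ⟨S, L', ⟨by simpa using net.isNClique o hS, hL', hiso⟩, fun e => ?_, fun e => ?_⟩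
  · rw [eval_index, hS, ← net.sameClass_iff hQ hou ha]
    refine ⟨fun ⟨o', u', hbase', he⟩ => ?_, fun he => ⟨o, u, hbase, he⟩⟩
    obtain ⟨rfl, rfl⟩ := hbase.unique hbase'
    exact he
  · rw [eval_entryDigit]
    constructor
    · rintro ⟨o', u', v', ⟨hbase', hsecond'⟩, z, hz, hmeet⟩
      obtain ⟨rfl, rfl⟩ := hbase.unique hbase'
      obtain rfl := hsecond.unique hsecond'
      obtain ⟨hx, hy, rfl⟩ := (hentry _ _ _).1 hz
      exact ⟨hx, hy, hmeet⟩
    · rintro ⟨hx, hy, hmeet⟩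
      exact ⟨o, u, v, ⟨hbase, hsecond⟩, _, (hentry _ _ _).2 ⟨hx, hy, rfl⟩, hmeet⟩

theorem exists_isRecovery {n : ℕ} {L : Fin n → Fin n → Fin n} (hL : IsLatinSquare L)
    {G : SimpleGraph (Fin (n ^ 2))} (e : G ≃g latinSquareGraph L) :
    ∃ S L', IsRecovery n G S L' := by
  have net := (isNet_latinSquareGraph hL).comap_iso e
  obtain ⟨S, hS⟩ : ∃ S, G.IsNClique n S := by
    rcases Nat.eq_zero_or_pos n with rfl | hn
    · exact ⟨∅, by simp⟩
    · have o : Fin (n ^ 2) := ⟨0, by positivity⟩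
      exact ⟨({x | (e o).1.1 = (e x).1.1} : Finset _), by simpa using net.isNClique o (by simp)⟩
  have labels := S.equivFinOfCardEq hS.card_eq
  obtain ⟨L', hL', hiso, -⟩ := net.exists_latinSquare labels labels labels
  exact ⟨S, L', hS, hL', hiso⟩

theorem exists_recovers {c : ℕ} (hc : 2 ≤ c) (n : ℕ) (x y z : Fin c) :
    ∃ φ ψ : Formula c, Recovers n x y z φ ψ := by
  have exists_of_isLatin (G : SimpleGraph (Fin (n ^ 2)))
      (h : ∃ L : Fin n → Fin n → Fin n, IsLatinSquare L ∧ Nonempty (G ≃g latinSquareGraph L)) :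
      ∃ S L', IsRecovery n G S L' :=
    let ⟨_, hL, ⟨e⟩⟩ := h
    exists_isRecovery hL e
  choose S L' hrec using exists_of_isLatin
  obtain ⟨φ, hφ⟩ := Formula.exists_eval_iff hc fun G a => ∃ h, a x ∈ S G h
  obtain ⟨ψ, hψ⟩ := Formula.exists_eval_iff hc fun G a =>
    ∃ h, EntryMeets (L' G h) (a x) (a y) (a z)
  refine ⟨φ, ψ, fun L hL G hG => ⟨S G ⟨L, hL, hG⟩, L' G ⟨L, hL, hG⟩, hrec G _, fun a => ?_,
    fun a => ?_⟩⟩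
  · rw [hφ, exists_prop_of_true ⟨L, hL, hG⟩]
  · rw [hψ, exists_prop_of_true ⟨L, hL, hG⟩]

end Recovery

/-! ### Assignments as binary words -/

section Assignments

/-- The `W` lowest binary digits of a family of numbers, least significant digit first. -/
def digitVecs {ι : Type*} : ℕ → (ι → ℕ) → List (ι → Bool)
  | 0, _ => []
  | W + 1, v => (fun x => decide (v x % 2 = 1)) :: digitVecs W fun x => v x / 2

theorem digitVecs_injOn {ι : Type*} {W : ℕ} {v v' : ι → ℕ} (hv : ∀ x, v x < 2 ^ W)
    (hv' : ∀ x, v' x < 2 ^ W) (h : digitVecs W v = digitVecs W v') : v = v' := by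
  induction W generalizing v v' with
  | zero =>
    funext x
    rw [Nat.lt_one_iff.1 (hv x), Nat.lt_one_iff.1 (hv' x)]
  | succ W ih =>
    simp only [digitVecs, List.cons.injEq] at h
    have half_lt {i : ℕ} (hi : i < 2 ^ (W + 1)) : i / 2 < 2 ^ W := by
      rw [pow_succ] at hi
      omega
    have half_eq := ih (fun x => half_lt (hv x)) (fun x => half_lt (hv' x)) h.2
    funext x
    have parity_iff := decide_eq_decide.1 (congrFun h.1 x)
    have := congrFun half_eq x
    omega

variable {c : ℕ}

/-- The values of `c` variables as one binary word: the lowest digits of all values, then the next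
digits of all values, and so on. -/
def assignmentWord (W : ℕ) (a : Fin c → ℕ) : List Bool :=
  (digitVecs W a).flatMap List.ofFn

theorem length_assignmentWord (W : ℕ) (a : Fin c → ℕ) : (assignmentWord W a).length = W * c := by
  unfold assignmentWord
  induction W generalizing a with
  | zero => simp [digitVecs]
  | succ W ih =>
    simp only [digitVecs, List.flatMap_cons, List.length_append, ih, List.length_ofFn]
    ring

theorem assignmentWord_injOn {W : ℕ} {a a' : Fin c → ℕ} (ha : ∀ x, a x < 2 ^ W)
    (ha' : ∀ x, a' x < 2 ^ W) (h : assignmentWord W a = assignmentWord W a') : a = a' := by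
  refine digitVecs_injOn ha ha' ?_
  clear ha ha'
  unfold assignmentWord at h
  induction W generalizing a a' with
  | zero => rfl
  | succ W ih =>
    simp only [digitVecs, List.flatMap_cons] at h ⊢
    obtain ⟨head_eq, tail_eq⟩ := List.append_inj h (by simp)
    rw [List.ofFn_inj.1 head_eq, ih tail_eq]

/-- All assignments that change `a` at the variables of a list to values below `m`, in lexicographic
order. -/
def assignments (m : ℕ) : List (Fin c) → (Fin c → ℕ) → List (Fin c → ℕ)
  | [], a => [a]
  | x :: xs, a => (List.range m).flatMap fun i => assignments m xs (Function.update a x i)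

theorem mem_assignments {m : ℕ} {xs : List (Fin c)} (hxs : xs.Nodup) {a b : Fin c → ℕ} :
    b ∈ assignments m xs a ↔ (∀ x ∈ xs, b x < m) ∧ ∀ x ∉ xs, b x = a x := by
  induction xs generalizing a with
  | nil => simp [assignments, funext_iff]
  | cons x xs ih =>
    obtain ⟨hx, hxs⟩ := List.nodup_cons.1 hxs
    simp only [assignments, List.mem_flatMap, List.mem_range, ih hxs, List.forall_mem_cons]
    constructor
    · rintro ⟨i, hi, lt, eq⟩
      refine ⟨⟨by rwa [eq x hx, Function.update_self], lt⟩, fun y hy => ?_⟩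
      obtain ⟨hyx, hy⟩ := List.ne_and_not_mem_of_not_mem_cons hy
      rw [eq y hy, Function.update_of_ne hyx]
    · rintro ⟨⟨hbx, lt⟩, eq⟩
      refine ⟨b x, hbx, lt, fun y hy => ?_⟩
      rcases eq_or_ne y x with rfl | hyx
      · rw [Function.update_self]
      · rw [Function.update_of_ne hyx, eq y (List.not_mem_cons_of_ne_of_not_mem hyx hy)]

theorem nodup_assignments {m : ℕ} {xs : List (Fin c)} (hxs : xs.Nodup) (a : Fin c → ℕ) :
    (assignments m xs a).Nodup := by
  induction xs generalizing a with
  | nil => exact List.nodup_singleton a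
  | cons x xs ih =>
    obtain ⟨hx, hxs⟩ := List.nodup_cons.1 hxs
    rw [assignments, List.nodup_flatMap]
    refine ⟨fun i _ => ih hxs _, List.nodup_range.imp fun {i j} hij => ?_⟩
    refine List.disjoint_left.2 fun b hi hj => hij ?_
    have value_eq {i : ℕ} (h : b ∈ assignments m xs (Function.update a x i)) : b x = i := by
      rw [((mem_assignments hxs).1 h).2 x hx, Function.update_self]
    exact (value_eq hi).symm.trans (value_eq hj)

theorem length_assignments {m : ℕ} (xs : List (Fin c)) (a : Fin c → ℕ) :
    (assignments m xs a).length = m ^ xs.length := by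
  induction xs generalizing a with
  | nil => simp [assignments]
  | cons x xs ih => simp [assignments, List.length_flatMap, ih, pow_succ, mul_comm]

/-- All assignments of values below `m` to `c` variables, in lexicographic order. -/
def allAssignments (c m : ℕ) : List (Fin c → ℕ) :=
  assignments m (List.finRange c) 0

theorem mem_allAssignments {m : ℕ} {a : Fin c → ℕ} :
    a ∈ allAssignments c m ↔ ∀ x, a x < m := by
  simp [allAssignments, mem_assignments (List.nodup_finRange c)]

theorem update_apply_lt {ι : Type*} [DecidableEq ι] {m : ℕ} {a : ι → ℕ} (ha : ∀ y, a y < m) {x : ι}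
    {i : ℕ} (hi : i < m) (y : ι) : Function.update a x i y < m := by
  rw [Function.update_apply]
  split_ifs
  exacts [hi, ha y]

end Assignments

/-! ### Evaluation along a list of gates -/

section Fold

variable {N : ℕ} {β : Type*} {F : GateOp N → (List Bool → β) → β} {l l' : List (Gate N)}
  {v : List Bool → β} {s : List Bool}

/-- The values at the gate labels after the gates of the list `l` have been evaluated by `F`. This
covers both the Boolean values and the depths of the gates. -/
def foldGates (F : GateOp N → (List Bool → β) → β) (l : List (Gate N)) (v : List Bool → β) :
    List Bool → β :=
  l.foldl (fun v g => Function.update v g.label (F g.op v)) v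

/-- `F` evaluates a gate from the values of the gates that feed it. -/
def DependsOnArgs (F : GateOp N → (List Bool → β) → β) : Prop :=
  ∀ o v v', (∀ s ∈ o.args, v s = v' s) → F o v = F o v'

theorem dependsOnArgs_eval (x : Fin N → Bool) : DependsOnArgs fun o => o.eval x
  | .input _, _, _, _ => rfl
  | .not s, _, _, h => congrArg not (h s (List.mem_singleton_self s))
  | .and _, _, _, h => by
    rw [Bool.eq_iff_iff]
    simp only [GateOp.eval, List.all_eq_true]
    exact forall₂_congr fun s hs => by rw [h s hs]
  | .or _, _, _, h => by
    rw [Bool.eq_iff_iff]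
    simp only [GateOp.eval, List.any_eq_true]
    exact exists_congr fun s => and_congr_right fun hs => by rw [h s hs]

theorem dependsOnArgs_depth : DependsOnArgs fun (o : GateOp N) d => o.depth d
  | .input _, _, _, _ => rfl
  | .not s, _, _, h => congrArg (· + 1) (h s (List.mem_singleton_self s))
  | .and _, _, _, h | .or _, _, _, h =>
    congrArg (List.foldr max 0 · + 1) (List.map_congr_left h)

theorem GateOp.depth_le (o : GateOp N) {depthOf : List Bool → ℕ} {d : ℕ}
    (h : ∀ s ∈ o.args, depthOf s ≤ d) : o.depth depthOf ≤ d + 1 := by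
  cases o with
  | input i => exact Nat.zero_le _
  | not s => exact Nat.succ_le_succ (h s (List.mem_singleton_self s))
  | and as | or as =>
    exact Nat.succ_le_succ (List.max_le_of_forall_le _ _ (List.forall_mem_map.2 h))

theorem foldGates_append (F : GateOp N → (List Bool → β) → β) (l l' : List (Gate N))
    (v : List Bool → β) : foldGates F (l ++ l') v = foldGates F l' (foldGates F l v) :=
  List.foldl_append

theorem foldGates_of_notMem (hs : s ∉ l.map Gate.label) : foldGates F l v s = v s := by
  induction l generalizing v with
  | nil => rfl
  | cons g l ih =>
    obtain ⟨hsg, hs⟩ := List.ne_and_not_mem_of_not_mem_cons hs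
    exact (ih hs).trans (Function.update_of_ne hsg _ _)

theorem foldGates_append_of_notMem (hs : s ∉ l'.map Gate.label) :
    foldGates F (l ++ l') v s = foldGates F l v s := by
  rw [foldGates_append, foldGates_of_notMem hs]

theorem foldGates_layer (hF : DependsOnArgs F) (nodup : (l.map Gate.label).Nodup)
    (indep : ∀ g ∈ l, ∀ t ∈ g.op.args, t ∉ l.map Gate.label) {g : Gate N} (hg : g ∈ l) :
    foldGates F l v g.label = F g.op v := by
  induction l generalizing v with
  | nil => exact absurd hg List.not_mem_nil
  | cons g' l ih =>
    change foldGates F l (Function.update v g'.label (F g'.op v)) g.label = _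
    obtain ⟨hg', nodup⟩ := List.nodup_cons.1 nodup
    rcases List.mem_cons.1 hg with rfl | hg
    · rw [foldGates_of_notMem hg', Function.update_self]
    · rw [ih nodup (fun k hk t ht ht' =>
        indep k (List.mem_cons_of_mem _ hk) t ht (List.mem_cons_of_mem _ ht')) hg]
      refine hF _ _ _ fun t ht => Function.update_of_ne ?_ _ _
      rintro rfl
      exact indep g (List.mem_cons_of_mem _ hg) _ ht List.mem_cons_self

theorem foldGates_append_le [LinearOrder β] {b b' : β}
    (hl : ∀ s ∈ l.map Gate.label, foldGates F l v s ≤ b)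
    (hl' : ∀ v, ∀ s ∈ l'.map Gate.label, foldGates F l' v s ≤ b')
    (hs : s ∈ (l ++ l').map Gate.label) : foldGates F (l ++ l') v s ≤ max b b' := by
  by_cases hsl' : s ∈ l'.map Gate.label
  · rw [foldGates_append]
    exact (hl' _ s hsl').trans (le_max_right _ _)
  · rw [foldGates_append_of_notMem hsl']
    rw [List.map_append, List.mem_append] at hs
    exact (hl s (hs.resolve_right hsl')).trans (le_max_left _ _)

/-- Each gate of the list is fed by labels in `T` or by earlier gates of the list. -/
def FedBy : Set (List Bool) → List (Gate N) → Prop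
  | _, [] => True
  | T, g :: l => (∀ s ∈ g.op.args, s ∈ T) ∧ FedBy (insert g.label T) l

namespace FedBy

variable {T T' : Set (List Bool)}

theorem mono (hT : T ⊆ T') (h : FedBy T l) : FedBy T' l := by
  induction l generalizing T T' with
  | nil => trivial
  | cons g l ih => exact ⟨fun s hs => hT (h.1 s hs), ih (Set.insert_subset_insert hT) h.2⟩

theorem append (h : FedBy T l) (h' : FedBy (T ∪ {s | s ∈ l.map Gate.label}) l') :
    FedBy T (l ++ l') := by
  induction l generalizing T with
  | nil => simpa using h'
  | cons g l ih =>
    refine ⟨h.1, ih h.2 (h'.mono fun s => ?_)⟩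
    simp only [List.map_cons, List.mem_cons, Set.mem_union, Set.mem_insert_iff, Set.mem_ofPred_eq]
    tauto

theorem of_forall (h : ∀ g ∈ l, ∀ s ∈ g.op.args, s ∈ T) : FedBy T l := by
  induction l generalizing T with
  | nil => trivial
  | cons g l ih =>
    obtain ⟨hg, hl⟩ := List.forall_mem_cons.1 h
    exact ⟨hg, ih fun k hk s hs => Set.mem_insert_of_mem _ (hl k hk s hs)⟩

theorem mem_of_mem_args {pre post : List (Gate N)} {g : Gate N} (h : FedBy T (pre ++ g :: post))
    (hs : s ∈ g.op.args) : s ∈ T ∨ s ∈ pre.map Gate.label := by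
  induction pre generalizing T with
  | nil => exact Or.inl (h.1 s hs)
  | cons k pre ih =>
    rcases ih h.2 with (rfl | hT) | hpre
    · exact Or.inr List.mem_cons_self
    · exact Or.inl hT
    · exact Or.inr (List.mem_cons_of_mem _ hpre)

end FedBy

end Fold

/-! ### Circuits of formulas -/

section Labels

variable {c N : ℕ} {p : List Bool}

/-- The number of binary digits that are used for each variable in gate labels. -/
def labelWidth (N : ℕ) : ℕ :=
  N.size + 3

theorem eight_mul_lt_two_pow_labelWidth (N : ℕ) : 8 * N < 2 ^ labelWidth N := by
  have := Nat.lt_size_self N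
  rw [labelWidth, pow_add]
  omega

theorem lt_two_pow_labelWidth (N : ℕ) : N < 2 ^ labelWidth N :=
  (Nat.le_mul_of_pos_left N (by norm_num)).trans_lt (eight_mul_lt_two_pow_labelWidth N)

theorem sqrt_lt_two_pow_labelWidth (N : ℕ) : N.sqrt < 2 ^ labelWidth N :=
  N.sqrt_le_self.trans_lt (lt_two_pow_labelWidth N)

/-- The label of the gate for the subformula at position `p` under the assignment `a`. -/
def gateLabel (N : ℕ) (p : List Bool) (a : Fin c → ℕ) : List Bool :=
  p ++ assignmentWord (labelWidth N) a

theorem length_gateLabel (N : ℕ) (p : List Bool) (a : Fin c → ℕ) :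
    (gateLabel N p a).length = p.length + labelWidth N * c := by
  simp [gateLabel, length_assignmentWord]

theorem gateLabel_injOn {a a' : Fin c → ℕ} (ha : ∀ x, a x < N.sqrt) (ha' : ∀ x, a' x < N.sqrt)
    (h : gateLabel N p a = gateLabel N p a') : a = a' := by
  have sqrt_lt := sqrt_lt_two_pow_labelWidth N
  exact assignmentWord_injOn (fun x => (ha x).trans sqrt_lt) (fun x => (ha' x).trans sqrt_lt)
    (List.append_cancel_left h)

/-- The gate that reads the input bit `i`, or a gate with the value `0` if there is no such bit. -/
def inputOp (N i : ℕ) : GateOp N :=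
  if h : i < N then .input ⟨i, h⟩ else .or []

theorem eval_inputOp {i : ℕ} {s : Fin N → Bool} {v : List Bool → Bool} :
    (inputOp N i).eval s v = true ↔ ∃ h : i < N, s ⟨i, h⟩ = true := by
  unfold inputOp
  split_ifs with h <;> simp [GateOp.eval, h]

/-- One gate for each assignment. -/
def gateLayer (N : ℕ) (p : List Bool) (f : (Fin c → ℕ) → GateOp N) : List (Gate N) :=
  (allAssignments c N.sqrt).map fun a => ⟨gateLabel N p a, f a⟩

variable {f : (Fin c → ℕ) → GateOp N}

theorem mem_gateLayer {g : Gate N} :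
    g ∈ gateLayer N p f ↔ ∃ a : Fin c → ℕ, (∀ x, a x < N.sqrt) ∧ ⟨gateLabel N p a, f a⟩ = g := by
  simp [gateLayer, mem_allAssignments]

theorem mem_labels_gateLayer {s : List Bool} :
    s ∈ (gateLayer N p f).map Gate.label ↔
      ∃ a : Fin c → ℕ, (∀ x, a x < N.sqrt) ∧ gateLabel N p a = s := by
  simp [gateLayer, mem_allAssignments]

theorem nodup_labels_gateLayer : ((gateLayer N p f).map Gate.label).Nodup := by
  rw [gateLayer, List.map_map]
  exact List.Nodup.map_on (fun a ha a' ha' h => gateLabel_injOn (mem_allAssignments.1 ha)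
    (mem_allAssignments.1 ha') h) (nodup_assignments (List.nodup_finRange c) 0)

end Labels

namespace Formula

variable {c N : ℕ} {p : List Bool} {φ : Formula c}

/-- The height of the syntax tree, which bounds the depth of the circuit. -/
def height : Formula c → ℕ
  | adj _ _ => 1
  | num _ => 1
  | not φ => φ.height + 1
  | and φ ψ => max φ.height ψ.height + 1
  | ex _ φ => φ.height + 1

/-- The number of nodes of the syntax tree. -/
def nodes : Formula c → ℕ
  | adj _ _ => 1
  | num _ => 1
  | not φ => φ.nodes + 1
  | and φ ψ => φ.nodes + ψ.nodes + 1
  | ex _ φ => φ.nodes + 1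

/-- The operation of the gate for a formula at position `p`. Children of a node stand at the
positions `p ++ [false]` and `p ++ [true]`. -/
def topOp (N : ℕ) (p : List Bool) : Formula c → (Fin c → ℕ) → GateOp N
  | adj x y, a => inputOp N (a x * N.sqrt + a y)
  | num q, a => if q a then .and [] else .or []
  | not _, a => .not (gateLabel N (p ++ [false]) a)
  | and _ _, a => .and [gateLabel N (p ++ [false]) a, gateLabel N (p ++ [true]) a]
  | ex x _, a => .or ((List.range N.sqrt).map fun i =>
      gateLabel N (p ++ [false]) (Function.update a x i))

/-- The gates for all subformulas of a formula at position `p`. -/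
def gates (N : ℕ) : List Bool → Formula c → List (Gate N)
  | p, adj x y => gateLayer N p (topOp N p (adj x y))
  | p, num q => gateLayer N p (topOp N p (num q))
  | p, not φ => gates N (p ++ [false]) φ ++ gateLayer N p (topOp N p (not φ))
  | p, and φ ψ => gates N (p ++ [false]) φ ++ gates N (p ++ [true]) ψ ++
      gateLayer N p (topOp N p (and φ ψ))
  | p, ex x φ => gates N (p ++ [false]) φ ++ gateLayer N p (topOp N p (ex x φ))

/-- The gates for the proper subformulas of a formula at position `p`. -/
def subGates (N : ℕ) (p : List Bool) : Formula c → List (Gate N)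
  | adj _ _ => []
  | num _ => []
  | not φ => gates N (p ++ [false]) φ
  | and φ ψ => gates N (p ++ [false]) φ ++ gates N (p ++ [true]) ψ
  | ex _ φ => gates N (p ++ [false]) φ

theorem gates_eq (N : ℕ) (p : List Bool) (φ : Formula c) :
    φ.gates N p = φ.subGates N p ++ gateLayer N p (φ.topOp N p) := by
  cases φ <;> simp [gates, subGates]

theorem length_gates (N : ℕ) (p : List Bool) (φ : Formula c) :
    (φ.gates N p).length = φ.nodes * N.sqrt ^ c := by
  induction φ generalizing p <;>
    simp_all [gates, nodes, gateLayer, allAssignments, length_assignments, add_mul, add_assoc]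

section LabelsOfGates

variable {s : List Bool}

theorem mem_labels_gates : s ∈ (φ.gates N p).map Gate.label ↔
    s ∈ (φ.subGates N p).map Gate.label ∨
      ∃ a : Fin c → ℕ, (∀ x, a x < N.sqrt) ∧ gateLabel N p a = s := by
  rw [gates_eq, List.map_append, List.mem_append, mem_labels_gateLayer]

theorem gateLabel_mem_labels_gates {a : Fin c → ℕ} (ha : ∀ x, a x < N.sqrt) :
    gateLabel N p a ∈ (φ.gates N p).map Gate.label :=
  mem_labels_gates.2 (Or.inr ⟨a, ha, rfl⟩)

mutual

theorem exists_gateLabel_of_mem_labels_gates {p : List Bool} {φ : Formula c}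
    (hs : s ∈ (φ.gates N p).map Gate.label) :
    ∃ (q : List Bool) (a : Fin c → ℕ), gateLabel N (p ++ q) a = s := by
  rcases mem_labels_gates.1 hs with hs | ⟨a, -, h⟩
  · obtain ⟨b, q, a, h⟩ := exists_gateLabel_of_mem_labels_subGates hs
    exact ⟨b :: q, a, h⟩
  · exact ⟨[], a, by rwa [List.append_nil]⟩
termination_by (φ, 1)

theorem exists_gateLabel_of_mem_labels_subGates {p : List Bool} {φ : Formula c}
    (hs : s ∈ (φ.subGates N p).map Gate.label) :
    ∃ (b : Bool) (q : List Bool) (a : Fin c → ℕ), gateLabel N (p ++ b :: q) a = s := by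
  have of_child {b : Bool}
      (h : ∃ (q : List Bool) (a : Fin c → ℕ), gateLabel N (p ++ [b] ++ q) a = s) :
      ∃ (b : Bool) (q : List Bool) (a : Fin c → ℕ), gateLabel N (p ++ b :: q) a = s :=
    let ⟨q, a, h⟩ := h
    ⟨b, q, a, by rwa [List.append_cons]⟩
  cases φ with
  | adj | num => exact absurd hs List.not_mem_nil
  | not φ | ex _ φ => exact of_child (exists_gateLabel_of_mem_labels_gates hs)
  | and φ ψ =>
    rw [subGates, List.map_append, List.mem_append] at hs
    exact hs.elim (fun h => of_child (exists_gateLabel_of_mem_labels_gates h))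
      fun h => of_child (exists_gateLabel_of_mem_labels_gates h)
termination_by (φ, 0)

end

theorem length_lt_of_mem_labels_subGates (hs : s ∈ (φ.subGates N p).map Gate.label) :
    p.length + labelWidth N * c < s.length := by
  obtain ⟨b, q, a, rfl⟩ := exists_gateLabel_of_mem_labels_subGates hs
  rw [length_gateLabel, List.length_append, List.length_cons]
  omega

theorem gateLabel_notMem_labels_subGates {a : Fin c → ℕ} :
    gateLabel N p a ∉ (φ.subGates N p).map Gate.label := fun h =>
  (length_lt_of_mem_labels_subGates h).ne' (length_gateLabel N p a)

theorem disjoint_labels_gates {q : List Bool} (hlen : p.length = q.length) (hpq : p ≠ q)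
    {φ ψ : Formula c} :
    ((φ.gates N p).map Gate.label).Disjoint ((ψ.gates N q).map Gate.label) := by
  intro s hp hq
  obtain ⟨p', a, rfl⟩ := exists_gateLabel_of_mem_labels_gates hp
  obtain ⟨q', a', h⟩ := exists_gateLabel_of_mem_labels_gates hq
  simp only [gateLabel, List.append_assoc] at h
  exact hpq (List.append_inj h hlen.symm).1.symm

theorem mem_labels_subGates_of_mem_args {a : Fin c → ℕ} (ha : ∀ x, a x < N.sqrt)
    (hs : s ∈ (φ.topOp N p a).args) : s ∈ (φ.subGates N p).map Gate.label := by
  cases φ with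
  | adj x y =>
    rw [topOp, inputOp] at hs
    split_ifs at hs <;> exact absurd hs List.not_mem_nil
  | num q =>
    rw [topOp] at hs
    split_ifs at hs <;> exact absurd hs List.not_mem_nil
  | not φ =>
    obtain rfl := List.mem_singleton.1 hs
    exact gateLabel_mem_labels_gates ha
  | and φ ψ =>
    rw [subGates, List.map_append, List.mem_append]
    obtain rfl | rfl := List.mem_pair.1 hs
    · exact Or.inl (gateLabel_mem_labels_gates ha)
    · exact Or.inr (gateLabel_mem_labels_gates ha)
  | ex x φ =>
    obtain ⟨i, hi, rfl⟩ := List.mem_map.1 hs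
    exact gateLabel_mem_labels_gates (update_apply_lt ha (List.mem_range.1 hi))

theorem nodup_labels_gates_of_subGates (h : ((φ.subGates N p).map Gate.label).Nodup) :
    ((φ.gates N p).map Gate.label).Nodup := by
  rw [gates_eq, List.map_append]
  refine h.append nodup_labels_gateLayer fun s hs hs' => ?_
  obtain ⟨a, -, rfl⟩ := mem_labels_gateLayer.1 hs'
  exact gateLabel_notMem_labels_subGates hs

theorem nodup_labels_gates : ((φ.gates N p).map Gate.label).Nodup := by
  induction φ generalizing p with
  | adj | num => exact nodup_labels_gates_of_subGates List.nodup_nil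
  | not φ ih | ex _ φ ih => exact nodup_labels_gates_of_subGates ih
  | and φ ψ ihφ ihψ =>
    refine nodup_labels_gates_of_subGates ?_
    rw [subGates, List.map_append]
    exact ihφ.append ihψ (disjoint_labels_gates (by simp) (by simp))

theorem fedBy_gates_of_subGates (h : FedBy ∅ (φ.subGates N p)) : FedBy ∅ (φ.gates N p) := by
  rw [gates_eq]
  refine h.append (FedBy.of_forall fun g hg s hs => Or.inr ?_)
  obtain ⟨a, ha, rfl⟩ := mem_gateLayer.1 hg
  exact mem_labels_subGates_of_mem_args ha hs

theorem fedBy_gates : FedBy ∅ (φ.gates N p) := by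
  induction φ generalizing p with
  | adj | num => exact fedBy_gates_of_subGates trivial
  | not φ ih | ex _ φ ih => exact fedBy_gates_of_subGates ih
  | and φ ψ ihφ ihψ =>
    exact fedBy_gates_of_subGates (ihφ.append (ihψ.mono (Set.empty_subset _)))

end LabelsOfGates

section Fold

variable {β : Type*} {F : GateOp N → (List Bool → β) → β} {v : List Bool → β}

theorem foldGates_gateLabel (hF : DependsOnArgs F) {a : Fin c → ℕ} (ha : ∀ x, a x < N.sqrt) :
    foldGates F (φ.gates N p) v (gateLabel N p a) =
      F (φ.topOp N p a) (foldGates F (φ.subGates N p) v) := by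
  rw [gates_eq, foldGates_append]
  refine foldGates_layer hF nodup_labels_gateLayer (fun g hg s hs hs' => ?_)
    (g := ⟨gateLabel N p a, φ.topOp N p a⟩) (mem_gateLayer.2 ⟨a, ha, rfl⟩)
  obtain ⟨b, hb, rfl⟩ := mem_gateLayer.1 hg
  obtain ⟨b', -, rfl⟩ := mem_labels_gateLayer.1 hs'
  exact gateLabel_notMem_labels_subGates (mem_labels_subGates_of_mem_args hb hs)

theorem foldGates_subGates {s : List Bool} (hs : s ∈ (φ.subGates N p).map Gate.label) :
    foldGates F (φ.gates N p) v s = foldGates F (φ.subGates N p) v s := by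
  rw [gates_eq, foldGates_append_of_notMem]
  intro h
  obtain ⟨a, -, rfl⟩ := mem_labels_gateLayer.1 h
  exact gateLabel_notMem_labels_subGates hs

end Fold

section Depth

variable {s : List Bool} {v : List Bool → ℕ}

theorem depth_le_of_subGates {d : ℕ}
    (h : ∀ t ∈ (φ.subGates N p).map Gate.label,
      foldGates (fun o depthOf => o.depth depthOf) (φ.subGates N p) v t ≤ d)
    (hs : s ∈ (φ.gates N p).map Gate.label) :
    foldGates (fun o depthOf => o.depth depthOf) (φ.gates N p) v s ≤ d + 1 := by
  rcases mem_labels_gates.1 hs with hs | ⟨a, ha, rfl⟩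
  · rw [foldGates_subGates hs]
    exact (h s hs).trans d.le_succ
  · rw [foldGates_gateLabel dependsOnArgs_depth ha]
    exact GateOp.depth_le _ fun t ht => h t (mem_labels_subGates_of_mem_args ha ht)

theorem depth_le_height (hs : s ∈ (φ.gates N p).map Gate.label) :
    foldGates (fun o depthOf => o.depth depthOf) (φ.gates N p) v s ≤ φ.height := by
  induction φ generalizing p v s with
  | adj | num => exact depth_le_of_subGates (by simp [subGates]) hs
  | not φ ih | ex _ φ ih => exact depth_le_of_subGates (fun _ => ih) hs
  | and φ ψ ihφ ihψ =>
    exact depth_le_of_subGates (fun _ => foldGates_append_le (fun _ => ihφ) fun _ _ => ihψ) hs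

end Depth

end Formula

/-- The relation on `{0, …, m - 1}` whose matrix is given by an input string, row by row. -/
def inputRel {N m : ℕ} (s : Fin N → Bool) (u w : Fin m) : Prop :=
  ∃ h : u * m + w < N, s ⟨u * m + w, h⟩ = true

theorem inputRel_adjacencyString {m : ℕ} (G : SimpleGraph (Fin m)) :
    inputRel (adjacencyString G) = G.Adj := by
  funext u w
  have index_eq : (finProdFinEquiv (u, w) : ℕ) = u * m + w := by
    rw [finProdFinEquiv_apply_val, mul_comm, add_comm]
  have hlt : (u * m + w : ℕ) < m * m := index_eq ▸ (finProdFinEquiv (u, w)).isLt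
  have hfin : (⟨u * m + w, hlt⟩ : Fin (m * m)) = finProdFinEquiv (u, w) := Fin.ext index_eq.symm
  simp only [inputRel, hlt, exists_true_left, hfin, adjacencyString, Equiv.symm_apply_apply,
    decide_eq_true_eq]

theorem Formula.foldGates_eval_gateLabel {c N : ℕ} {p : List Bool} {φ : Formula c}
    {s : Fin N → Bool} {v : List Bool → Bool} {a : Fin c → Fin N.sqrt} :
    foldGates (fun o v => o.eval s v) (φ.gates N p) v (gateLabel N p fun x => a x) = true ↔
      φ.eval (inputRel s) a := by
  induction φ generalizing p v a <;>
    rw [foldGates_gateLabel (dependsOnArgs_eval s) fun x => (a x).isLt]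
  case adj x y => exact eval_inputOp
  case num q =>
    rw [topOp, eval]
    split_ifs with h <;> simp [GateOp.eval, h]
  case not φ ih =>
    rw [topOp, eval, GateOp.eval, ← ih, Bool.not_eq_true', Bool.not_eq_true, subGates]
  case and φ ψ ihφ ihψ =>
    have left_value := foldGates_append_of_notMem (F := fun o v => o.eval s v)
      (l := φ.gates N (p ++ [false])) (v := v)
      (disjoint_labels_gates (q := p ++ [true]) (ψ := ψ) (by simp) (by simp)
        (gateLabel_mem_labels_gates (p := p ++ [false]) (φ := φ) fun x => (a x).isLt))
    have eval_and (v : List Bool → Bool) (t t' : List Bool) :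
        (GateOp.and [t, t']).eval s v = (v t && v t') := by simp [GateOp.eval]
    rw [topOp, eval_and, Bool.and_eq_true, subGates, left_value, ihφ, foldGates_append, ihψ, eval]
  case ex x φ ih =>
    have coe_update (i : Fin N.sqrt) : (fun y => (Function.update a x i y : ℕ)) =
        Function.update (fun y => (a y : ℕ)) x i := Function.comp_update Fin.val a x i
    simp only [topOp, GateOp.eval, List.any_eq_true, List.mem_map, List.mem_range, subGates,
      exists_exists_and_eq_and, eval, Fin.exists_iff, ← ih (p := p ++ [false]) (v := v), coe_update,
      exists_prop]

/-! ### The circuit of a pair of formulas -/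

section QueryCircuit

variable {c N : ℕ} {x y z : Fin c} {φ ψ : Formula c}

/-- The circuit that writes, for all values `u` of the variable `x`, the truth value of `φ`, and
then for all values `u`, `w` of `x`, `y` and all powers of two `2 ^ b` below the number of vertices
as values of `z`, the truth value of `ψ`. -/
def queryCircuit (N : ℕ) (x y z : Fin c) (φ ψ : Formula c) : Circuit N where
  gates := φ.gates N [false] ++ ψ.gates N [true]
  outputs := (List.range N.sqrt).map (fun u => gateLabel N [false] (Function.update 0 x u)) ++
    (List.range N.sqrt).flatMap fun u => (List.range N.sqrt).flatMap fun w =>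
      (List.range (Nat.clog 2 N.sqrt)).map fun b => gateLabel N [true]
        (Function.update (Function.update (Function.update 0 x u) y w) z (2 ^ b))

theorem update_zero_lt {m u : ℕ} (hu : u < m) (i : Fin c) :
    Function.update (0 : Fin c → ℕ) x u i < m :=
  update_apply_lt (fun _ => u.zero_le.trans_lt hu) hu i

theorem update_update_update_zero_lt {m u w b : ℕ} (hu : u < m) (hw : w < m)
    (hb : b < Nat.clog 2 m) (i : Fin c) :
    Function.update (Function.update (Function.update (0 : Fin c → ℕ) x u) y w) z (2 ^ b) i < m :=
  update_apply_lt (update_apply_lt (update_zero_lt hu) hw)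
    ((Nat.lt_clog_iff_pow_lt one_lt_two).1 hb) i

theorem queryCircuit_wellFormed : (queryCircuit N x y z φ ψ).WellFormed := by
  refine ⟨?_, fun pre g post h s hs => ?_, fun s hs => ?_⟩
  · rw [queryCircuit, List.map_append]
    exact Formula.nodup_labels_gates.append Formula.nodup_labels_gates
      (Formula.disjoint_labels_gates (by simp) (by simp))
  · have fedBy : FedBy ∅ (queryCircuit N x y z φ ψ).gates :=
      Formula.fedBy_gates.append (Formula.fedBy_gates.mono (Set.empty_subset _))
    rw [h] at fedBy
    exact (fedBy.mem_of_mem_args hs).resolve_left (Set.notMem_empty _)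
  · simp only [queryCircuit, List.mem_append, List.mem_map, List.mem_flatMap, List.mem_range] at hs
    rw [queryCircuit, List.map_append, List.mem_append]
    rcases hs with ⟨u, hu, rfl⟩ | ⟨u, hu, w, hw, b, hb, rfl⟩
    · exact Or.inl (Formula.gateLabel_mem_labels_gates (update_zero_lt hu))
    · exact Or.inr (Formula.gateLabel_mem_labels_gates (update_update_update_zero_lt hu hw hb))

theorem queryCircuit_depth_le : (queryCircuit N x y z φ ψ).depth ≤ max φ.height ψ.height :=
  List.max_le_of_forall_le _ _ <| List.forall_mem_map.2 fun _ hg =>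
    foldGates_append_le (fun _ => Formula.depth_le_height) (fun _ _ => Formula.depth_le_height)
      (List.mem_map_of_mem hg)

theorem queryCircuit_size :
    (queryCircuit N x y z φ ψ).size = (φ.nodes + ψ.nodes) * N.sqrt ^ c := by
  simp [Circuit.size, queryCircuit, Formula.length_gates, add_mul]

theorem mul_pow_le_pow_add_self {l c k : ℕ} (hk : l + c ≤ k) : l * N ^ c ≤ N ^ k + k := by
  rcases le_or_gt N 1 with hN | hN
  · calc l * N ^ c ≤ l * 1 ^ c := Nat.mul_le_mul_left _ (Nat.pow_le_pow_left hN c)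
      _ ≤ N ^ k + k := by rw [one_pow]; omega
  · calc l * N ^ c ≤ N ^ l * N ^ c := Nat.mul_le_mul_right _ (Nat.lt_pow_self hN).le
      _ = N ^ (l + c) := (pow_add _ _ _).symm
      _ ≤ N ^ k := Nat.pow_le_pow_right hN.le hk
      _ ≤ N ^ k + k := Nat.le_add_right _ _

theorem queryCircuit_size_le {k : ℕ} (hk : φ.nodes + ψ.nodes + c ≤ k) :
    (queryCircuit N x y z φ ψ).size ≤ N ^ k + k := by
  rw [queryCircuit_size]
  exact (Nat.mul_le_mul_left _ (Nat.pow_le_pow_left N.sqrt_le_self c)).trans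
    (mul_pow_le_pow_add_self hk)

section Values

variable {s : Fin N → Bool} {a : Fin c → ℕ} (ha : ∀ i, a i < N.sqrt)

theorem values_queryCircuit_left :
    (queryCircuit N x y z φ ψ).values s (gateLabel N [false] a) = true ↔
      φ.eval (inputRel s) fun i => ⟨a i, ha i⟩ := by
  change foldGates (fun o v => o.eval s v) (φ.gates N [false] ++ ψ.gates N [true]) _ _ = _ ↔ _
  rw [foldGates_append_of_notMem]
  · exact Formula.foldGates_eval_gateLabel (a := fun i => ⟨a i, ha i⟩)
  · exact Formula.disjoint_labels_gates (p := [false]) (by simp) (by simp)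
      (Formula.gateLabel_mem_labels_gates (φ := φ) ha)

theorem values_queryCircuit_right :
    (queryCircuit N x y z φ ψ).values s (gateLabel N [true] a) = true ↔
      ψ.eval (inputRel s) fun i => ⟨a i, ha i⟩ := by
  change foldGates (fun o v => o.eval s v) (φ.gates N [false] ++ ψ.gates N [true]) _ _ = _ ↔ _
  rw [foldGates_append]
  exact Formula.foldGates_eval_gateLabel (a := fun i => ⟨a i, ha i⟩)

end Values

theorem queryCircuit_eval {s : Fin N → Bool} {m : ℕ} (hm : N.sqrt = m) {S : Finset (Fin m)}
    {L : S → S → S} (hxy : x ≠ y) (hxz : x ≠ z) (hyz : y ≠ z)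
    (hφ : ∀ a, φ.eval (inputRel s) a ↔ a x ∈ S)
    (hψ : ∀ a, ψ.eval (inputRel s) a ↔ EntryMeets L (a x) (a y) (a z)) :
    (queryCircuit N x y z φ ψ).eval s = latinSquareString S L := by
  subst hm
  have testBit_iff (i b : ℕ) : i &&& 2 ^ b ≠ 0 ↔ i.testBit b = true := by
    rw [Nat.and_two_pow]
    cases i.testBit b <;> simp
  change List.map _ (List.map _ _ ++ List.flatMap _ _) = _
  rw [latinSquareString, ← List.map_coe_finRange_eq_range]
  simp only [List.map_append, List.map_map, List.map_flatMap, List.flatMap_map]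
  congr 1
  · refine List.map_congr_left fun u _ => ?_
    rw [Bool.eq_iff_iff, Function.comp_apply, Function.comp_apply,
      values_queryCircuit_left (update_zero_lt u.isLt), hφ, decide_eq_true_eq]
    simp only [Function.update_self, Fin.eta]
  · refine List.flatMap_congr fun u _ => List.flatMap_congr fun w _ =>
      List.map_congr_left fun b hb => ?_
    rw [Bool.eq_iff_iff, Function.comp_apply, values_queryCircuit_right
      (update_update_update_zero_lt u.isLt w.isLt (List.mem_range.1 hb)), hψ]
    simp only [EntryMeets, Function.update_self, Function.update_of_ne hxy,
      Function.update_of_ne hxz, Function.update_of_ne hyz, testBit_iff, Fin.eta]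
    split_ifs with h
    · exact exists_prop_of_true h.1 |>.trans (exists_prop_of_true h.2)
    · rw [Nat.zero_testBit]
      exact iff_of_false (fun ⟨hu, hw, _⟩ => h ⟨hu, hw⟩) Bool.false_ne_true

end QueryCircuit

/-! ### Machines that sweep over a word of digit vectors -/

section Paths

variable {I O : Type}

/-- The configuration `c'` is reached from `c`, and all configurations before `c'` have their heads
in the first `s` cells. -/
def Transducer.PathWithin (M : Transducer I O) (w : List I) (s : ℕ) : M.Config → M.Config → Prop :=
  Relation.ReflTransGen fun c c' => M.step w c = some c' ∧ ∀ t, c.heads t < s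

variable {M : Transducer I O} {w : List I} {s : ℕ} {c c' c'' : M.Config}

theorem Transducer.PathWithin.trans (h : M.PathWithin w s c c') (h' : M.PathWithin w s c' c'') :
    M.PathWithin w s c c'' :=
  Relation.ReflTransGen.trans h h'

/-- The machine is deterministic, so every configuration it can reach lies on the path to the
halting one. -/
theorem Transducer.PathWithin.of_reaches {d : M.Config} (h : M.PathWithin w s c c')
    (hc' : M.step w c' = none) (hd : StateTransition.Reaches (M.step w) c d) :
    M.PathWithin w s d c' := by
  induction hd with
  | refl => exact h
  | @tail d e _ hstep ih =>
    rcases Relation.ReflTransGen.cases_head ih with rfl | ⟨e', ⟨he', -⟩, hpath⟩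
    · exact absurd (hc'.symm.trans hstep) (by simp)
    · obtain rfl : e' = e := Option.some_injective _ (he'.symm.trans hstep)
      exact hpath

theorem Transducer.outputsInSpace_of_pathWithin (h : M.PathWithin w s M.init c)
    (hc : M.step w c = none) (hs : ∀ t, c.heads t < s) : M.OutputsInSpace w c.output s := by
  refine ⟨⟨c, Relation.ReflTransGen.mono (fun _ _ h => h.1) _ _ h, hc, rfl⟩, fun d hd => ?_⟩
  rcases Relation.ReflTransGen.cases_head (h.of_reaches hc hd) with rfl | ⟨_, ⟨-, hd'⟩, -⟩
  exacts [hs, hd']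

theorem Transducer.readInput_of_lt {k : ℕ} (hk : k < w.length) :
    Transducer.readInput w (k + 1) = .symbol w[k] := by
  simp [Transducer.readInput, List.getElem?_eq_getElem hk]

theorem Transducer.readInput_length_succ :
    Transducer.readInput w (w.length + 1) = .rightEnd := by
  simp [Transducer.readInput]

end Paths

section Sweep

variable {V O : Type}

/-- A tape symbol: blank, the left end marker, or a vector of binary digits. -/
abbrev TapeSymbol (V : Type) : Type :=
  Option (Option (V → Bool))

/-- A transducer with unary input and a single work tape. -/
def singleTape [Finite V] (Q : Type) [Finite Q] (start : Q)
    (δ : Q → InputCell Unit → TapeSymbol V →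
      Option (Q × HeadMove × TapeSymbol V × HeadMove × List O)) : Transducer Unit O where
  Q := Q
  finiteQ := inferInstance
  start := start
  K := Unit
  finiteK := inferInstance
  Γ := TapeSymbol V
  finiteΓ := inferInstance
  blank := none
  δ q i γ := (δ q i (γ ())).map fun r => (r.1, r.2.1, fun _ => (r.2.2.1, r.2.2.2.1), r.2.2.2.2)

/-- The tape with the left end marker in cell `0` and the word `l` next to it. -/
def tapeOf (l : List (V → Bool)) : ℕ → TapeSymbol V
  | 0 => some none
  | i + 1 => (l[i]?).map some

theorem update_tapeOf_append (l l' : List (V → Bool)) (d d' : V → Bool) :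
    Function.update (tapeOf (l ++ d :: l')) (l.length + 1) (some (some d')) =
      tapeOf (l ++ d' :: l') := by
  funext i
  rcases i with _ | i
  · rfl
  · grind [tapeOf]

theorem update_tapeOf_length (l : List (V → Bool)) (d : V → Bool) :
    Function.update (tapeOf l) (l.length + 1) (some (some d)) = tapeOf (l ++ [d]) := by
  funext i
  rcases i with _ | i
  · rfl
  · grind [tapeOf]

theorem update_blank_eq_tapeOf_nil :
    Function.update (fun _ : ℕ => none) 0 (some none) = tapeOf ([] : List (V → Bool)) := by
  funext i
  cases i <;> rfl

theorem tapeOf_append_cons (l l' : List (V → Bool)) (d : V → Bool) :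
    tapeOf (l ++ d :: l') (l.length + 1) = some (some d) := by
  simp [tapeOf]

theorem tapeOf_length (l : List (V → Bool)) : tapeOf l (l.length + 1) = none := by
  simp [tapeOf]

theorem tapeOf_succ_ne (l : List (V → Bool)) (i : ℕ) : tapeOf l (i + 1) ≠ some none := by
  cases h : l[i]? <;> simp [tapeOf, h]

section SingleTape

variable [Finite V] {Q : Type} [Finite Q] {start : Q} {δ : Q → InputCell Unit → TapeSymbol V →
  Option (Q × HeadMove × TapeSymbol V × HeadMove × List O)} {w : List Unit} {s i h : ℕ} {q q' : Q}
  {T : ℕ → TapeSymbol V} {γ : TapeSymbol V} {mi mh : HeadMove} {o o' : List O}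

/-- The configuration of a `singleTape` machine in state `q`, with input head at `i`, work tape `T`,
work head at `h` and output `o`. -/
def tapeConfig (q : Q) (i : ℕ) (T : ℕ → TapeSymbol V) (h : ℕ) (o : List O) :
    (singleTape Q start δ).Config :=
  ⟨q, i, fun _ => T, fun _ => h, o⟩

theorem pathWithin_step
    (hδ : δ q (Transducer.readInput w i) (T h) = some (q', mi, γ, mh, o'))
    (hi : mi.apply i ≤ w.length + 1) (hh : h < s) :
    (singleTape Q start δ).PathWithin w s (tapeConfig q i T h o)
      (tapeConfig q' (mi.apply i) (Function.update T h γ) (mh.apply h) (o ++ o')) := by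
  refine Relation.ReflTransGen.single ⟨?_, fun _ => hh⟩
  simp [Transducer.step, singleTape, tapeConfig, hδ, hi]

theorem pathWithin_write
    (hδ : δ q (Transducer.readInput w i) (T h) = some (q', .stay, γ, mh, o'))
    (hi : i ≤ w.length + 1) (hh : h < s) :
    (singleTape Q start δ).PathWithin w s (tapeConfig q i T h o)
      (tapeConfig q' i (Function.update T h γ) (mh.apply h) (o ++ o')) :=
  pathWithin_step hδ hi hh

theorem pathWithin_move
    (hδ : δ q (Transducer.readInput w i) (T h) = some (q', mi, T h, mh, []))
    (hi : mi.apply i ≤ w.length + 1) (hh : h < s) :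
    (singleTape Q start δ).PathWithin w s (tapeConfig q i T h o)
      (tapeConfig q' (mi.apply i) T (mh.apply h) o) := by
  simpa using pathWithin_step (start := start) (o := o) hδ hi hh

theorem pathWithin_overwrite {l l' : List (V → Bool)} {d d' : V → Bool}
    (hδ : δ q (Transducer.readInput w i) (some (some d)) =
      some (q', .stay, some (some d'), mh, o'))
    (hi : i ≤ w.length + 1) (hs : l.length + 1 < s) :
    (singleTape Q start δ).PathWithin w s (tapeConfig q i (tapeOf (l ++ d :: l')) (l.length + 1) o)
      (tapeConfig q' i (tapeOf (l ++ d' :: l')) (mh.apply (l.length + 1)) (o ++ o')) := by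
  rw [← tapeOf_append_cons l l' d] at hδ
  rw [← update_tapeOf_append l l' d d']
  exact pathWithin_write (start := start) (o := o) hδ hi hs

theorem pathWithin_extend {l : List (V → Bool)} {d : V → Bool}
    (hδ : δ q (Transducer.readInput w i) none = some (q', .stay, some (some d), mh, []))
    (hi : i ≤ w.length + 1) (hs : l.length + 1 < s) :
    (singleTape Q start δ).PathWithin w s (tapeConfig q i (tapeOf l) (l.length + 1) o)
      (tapeConfig q' i (tapeOf (l ++ [d])) (mh.apply (l.length + 1)) o) := by
  rw [← tapeOf_length l] at hδ
  rw [← update_tapeOf_length]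
  simpa using pathWithin_write (start := start) (o := o) hδ hi hs

theorem pathWithin_return {l : List (V → Bool)}
    (hδ : ∀ a γ, γ ≠ some none → δ q a γ = some (q, .stay, γ, .left, []))
    (hδ₀ : δ q (Transducer.readInput w i) (some none) = some (q', mi, some none, .stay, []))
    (hi : i ≤ w.length + 1) (hi' : mi.apply i ≤ w.length + 1) (hh : h < s) :
    (singleTape Q start δ).PathWithin w s (tapeConfig q i (tapeOf l) h o)
      (tapeConfig q' (mi.apply i) (tapeOf l) 0 o) := by
  induction h with
  | zero => exact pathWithin_move (T := tapeOf l) hδ₀ hi' hh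
  | succ h ih =>
    exact .trans (pathWithin_move (hδ _ _ (tapeOf_succ_ne l h)) hi hh) (ih (by omega))

end SingleTape

/-- A left-to-right pass over the word on the tape with one bit of memory. -/
structure SweepOp (V O : Type) : Type where
  start : Bool
  digit : Bool → (V → Bool) → Bool × (V → Bool) × List O

/-- The final memory bit, the new word and the output of a pass. -/
def SweepOp.run (M : SweepOp V O) : Bool → List (V → Bool) → Bool × List (V → Bool) × List O
  | b, [] => (b, [], [])
  | b, d :: l =>
    ((M.run (M.digit b d).1 l).1, (M.digit b d).2.1 :: (M.run (M.digit b d).1 l).2.1,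
      (M.digit b d).2.2 ++ (M.run (M.digit b d).1 l).2.2)

theorem SweepOp.length_run (M : SweepOp V O) (b : Bool) (l : List (V → Bool)) :
    (M.run b l).2.1.length = l.length := by
  induction l generalizing b with
  | nil => rfl
  | cons d l ih => simp [SweepOp.run, ih]

/-- Structured programs over the word on the tape; `ite` and `loop` branch on the final memory bit
of a pass. -/
inductive Prog (V O : Type) : Type
  | emit (w : List O)
  | op (M : SweepOp V O)
  | seq (p q : Prog V O)
  | ite (M : SweepOp V O) (p q : Prog V O)
  | loop (M : SweepOp V O) (p : Prog V O)

/-- Big-step semantics: the program turns the first word into the second and produces an output. -/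
inductive Prog.Exec : Prog V O → List (V → Bool) → List (V → Bool) → List O → Prop
  | emit (w : List O) (l : List (V → Bool)) : Exec (.emit w) l l w
  | op (M : SweepOp V O) (l : List (V → Bool)) :
      Exec (.op M) l (M.run M.start l).2.1 (M.run M.start l).2.2
  | seq {p q : Prog V O} {l l' l'' : List (V → Bool)} {o o' : List O} (hp : Exec p l l' o)
      (hq : Exec q l' l'' o') : Exec (.seq p q) l l'' (o ++ o')
  | ite_true {M : SweepOp V O} {p q : Prog V O} {l l' : List (V → Bool)} {o : List O}
      (h : (M.run M.start l).1 = true) (hp : Exec p (M.run M.start l).2.1 l' o) :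
      Exec (.ite M p q) l l' ((M.run M.start l).2.2 ++ o)
  | ite_false {M : SweepOp V O} {p q : Prog V O} {l l' : List (V → Bool)} {o : List O}
      (h : (M.run M.start l).1 = false) (hq : Exec q (M.run M.start l).2.1 l' o) :
      Exec (.ite M p q) l l' ((M.run M.start l).2.2 ++ o)
  | loop_true {M : SweepOp V O} {p : Prog V O} {l l' l'' : List (V → Bool)} {o o' : List O}
      (h : (M.run M.start l).1 = true) (hp : Exec p (M.run M.start l).2.1 l' o)
      (hl : Exec (.loop M p) l' l'' o') :
      Exec (.loop M p) l l'' ((M.run M.start l).2.2 ++ (o ++ o'))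
  | loop_false {M : SweepOp V O} {p : Prog V O} {l : List (V → Bool)}
      (h : (M.run M.start l).1 = false) :
      Exec (.loop M p) l (M.run M.start l).2.1 (M.run M.start l).2.2

theorem Prog.Exec.length_eq {p : Prog V O} {l l' : List (V → Bool)} {o : List O}
    (h : p.Exec l l' o) : l'.length = l.length := by
  induction h <;> simp_all [SweepOp.length_run]

/-- The control states of a pass with memory `b`: scanning to the right, and returning to the left
end. -/
inductive SweepState : Type
  | scan (b : Bool)
  | back (b : Bool)
  deriving Fintype

/-- One step of a pass, with states embedded into `Q` by `e` and continued in the states `k`. -/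
def SweepOp.trans {Q : Type} (M : SweepOp V O) (e : SweepState → Q) (k : Bool → Q) :
    SweepState → TapeSymbol V → Q × TapeSymbol V × HeadMove × List O
  | .scan b, some none => (e (.scan b), some none, .right, [])
  | .scan b, some (some d) =>
    (e (.scan (M.digit b d).1), some (some (M.digit b d).2.1), .right, (M.digit b d).2.2)
  | .scan b, none => (e (.back b), none, .left, [])
  | .back b, some none => (k b, some none, .stay, [])
  | .back b, γ => (e (.back b), γ, .left, [])

theorem SweepOp.trans_back {Q : Type} (M : SweepOp V O) (e : SweepState → Q) (k : Bool → Q)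
    (b : Bool) {γ : TapeSymbol V} (hγ : γ ≠ some none) :
    M.trans e k (.back b) γ = (e (.back b), γ, .left, []) := by
  rcases γ with _ | _ | d
  exacts [rfl, absurd rfl hγ, rfl]

namespace Prog

/-- The control states of a program. -/
def State : Prog V O → Type
  | emit _ => Unit
  | op _ => SweepState
  | seq p q => p.State ⊕ q.State
  | ite _ p q => SweepState ⊕ (p.State ⊕ q.State)
  | loop _ p => SweepState ⊕ p.State

theorem finite_state (p : Prog V O) : Finite p.State := by
  induction p with
  | emit w => exact inferInstanceAs (Finite Unit)
  | op M => exact inferInstanceAs (Finite SweepState)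
  | seq p q ihp ihq => exact inferInstanceAs (Finite (p.State ⊕ q.State))
  | ite M p q ihp ihq => exact inferInstanceAs (Finite (SweepState ⊕ (p.State ⊕ q.State)))
  | loop M p ihp => exact inferInstanceAs (Finite (SweepState ⊕ p.State))

/-- The control state in which a program begins. -/
def first : (p : Prog V O) → p.State
  | emit _ => ()
  | op M => .scan M.start
  | seq p _ => .inl p.first
  | ite M _ _ => .inl (.scan M.start)
  | loop M _ => .inl (.scan M.start)

/-- One step of a program, with control states embedded into `Q` by `e` and continued in `k`. -/
def trans {Q : Type} : (p : Prog V O) → (e : p.State → Q) → (k : Q) → p.State → TapeSymbol V →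
    Q × TapeSymbol V × HeadMove × List O
  | emit w, _, k, _, γ => (k, γ, .stay, w)
  | op M, e, k, s, γ => M.trans e (fun _ => k) s γ
  | seq p q, e, _, .inl s, γ => p.trans (fun t => e (.inl t)) (e (.inr q.first)) s γ
  | seq _ q, e, k, .inr s, γ => q.trans (fun t => e (.inr t)) k s γ
  | ite M p q, e, _, .inl s, γ => M.trans (fun t => e (.inl t))
      (fun b => if b then e (.inr (.inl p.first)) else e (.inr (.inr q.first))) s γ
  | ite _ p _, e, k, .inr (.inl s), γ => p.trans (fun t => e (.inr (.inl t))) k s γ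
  | ite _ _ q, e, k, .inr (.inr s), γ => q.trans (fun t => e (.inr (.inr t))) k s γ
  | loop M p, e, k, .inl s, γ => M.trans (fun t => e (.inl t))
      (fun b => if b then e (.inr p.first) else k) s γ
  | loop M p, e, _, .inr s, γ =>
    p.trans (fun t => e (.inr t)) (e (.inl (.scan M.start))) s γ

end Prog

section Simulation

variable [Finite V] {Q : Type} [Finite Q] {start : Q} {δ : Q → InputCell Unit → TapeSymbol V →
  Option (Q × HeadMove × TapeSymbol V × HeadMove × List O)} {w : List Unit} {s i : ℕ}

section Pass

variable {M : SweepOp V O} {e : SweepState → Q} {k : Bool → Q}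

theorem pathWithin_scan
    (hδ : ∀ t a γ, δ (e t) a γ = some ((M.trans e k t γ).1, .stay, (M.trans e k t γ).2))
    (hi : i ≤ w.length + 1)
    (l l' : List (V → Bool)) (b : Bool) (o : List O)
    (hs : l.length + l'.length + 1 < s) :
    (singleTape Q start δ).PathWithin w s
      (tapeConfig (e (.scan b)) i (tapeOf (l ++ l')) (l.length + 1) o)
      (tapeConfig (e (.back (M.run b l').1)) i (tapeOf (l ++ (M.run b l').2.1))
        (l.length + l'.length) (o ++ (M.run b l').2.2)) := by
  induction l' generalizing l b o with
  | nil =>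
    rw [List.append_nil, SweepOp.run, List.append_nil, List.append_nil]
    exact pathWithin_move (mi := .stay) (mh := .left) (by rw [hδ, tapeOf_length]; rfl) hi hs
  | cons d l' ih =>
    refine .trans (pathWithin_overwrite (hδ (.scan b) _ _) hi (by grind)) ?_
    simpa [SweepOp.run, SweepOp.trans, add_right_comm, HeadMove.apply, ← add_assoc] using
      ih (l ++ [(M.digit b d).2.1]) (M.digit b d).1 (o ++ (M.digit b d).2.2) (by grind)

theorem pathWithin_sweep
    (hδ : ∀ t a γ, δ (e t) a γ = some ((M.trans e k t γ).1, .stay, (M.trans e k t γ).2))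
    (hi : i ≤ w.length + 1)
    (l : List (V → Bool)) (o : List O) (hs : l.length + 1 < s) {b : Bool}
    (hb : (M.run M.start l).1 = b) :
    (singleTape Q start δ).PathWithin w s
      (tapeConfig (e (.scan M.start)) i (tapeOf l) 0 o)
      (tapeConfig (k b) i (tapeOf (M.run M.start l).2.1) 0 (o ++ (M.run M.start l).2.2)) := by
  subst hb
  have hscan := pathWithin_scan (start := start) hδ hi [] l M.start o (by simpa using hs)
  simp only [List.nil_append, List.length_nil, Nat.zero_add] at hscan
  exact .trans (pathWithin_move (mi := .stay) (by rw [hδ]; rfl) hi (by omega)) <| .trans hscan <|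
    pathWithin_return (mi := .stay) (fun a γ hγ => by rw [hδ, M.trans_back e k _ hγ])
      (by rw [hδ]; rfl) hi hi (by omega)

end Pass

theorem Prog.Exec.pathWithin {p : Prog V O} {l l' : List (V → Bool)} {o : List O}
    (h : p.Exec l l' o) {e : p.State → Q} {k : Q}
    (hδ : ∀ t a γ, δ (e t) a γ = some ((p.trans e k t γ).1, .stay, (p.trans e k t γ).2))
    (hi : i ≤ w.length + 1) (o' : List O) (hs : l.length + 1 < s) :
    (singleTape Q start δ).PathWithin w s (tapeConfig (e p.first) i (tapeOf l) 0 o')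
      (tapeConfig k i (tapeOf l') 0 (o' ++ o)) := by
  induction h generalizing k o' with
  | emit u l =>
    simpa [Prog.trans, Prog.first, HeadMove.apply] using pathWithin_write (start := start) (o := o')
      (T := tapeOf l) (hδ () _ _) hi (Nat.zero_lt_of_lt hs)
  | op M l => exact pathWithin_sweep (k := fun _ => k) hδ hi l o' hs rfl
  | seq hp _ ihp ihq =>
    rw [← List.append_assoc]
    exact .trans (ihp (fun t => hδ (.inl t)) o' hs)
      (ihq (fun t => hδ (.inr t)) _ (by rwa [hp.length_eq]))
  | ite_true hb _ ih =>
    rw [← List.append_assoc]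
    exact .trans (pathWithin_sweep (fun t => hδ (.inl t)) hi _ o' hs hb)
      (ih (fun t => hδ (.inr (.inl t))) _ (by rwa [SweepOp.length_run]))
  | ite_false hb _ ih =>
    rw [← List.append_assoc]
    exact .trans (pathWithin_sweep (fun t => hδ (.inl t)) hi _ o' hs hb)
      (ih (fun t => hδ (.inr (.inr t))) _ (by rwa [SweepOp.length_run]))
  | loop_true hb hp _ ihp ihl =>
    rw [← List.append_assoc, ← List.append_assoc]
    exact .trans (pathWithin_sweep (fun t => hδ (.inl t)) hi _ o' hs hb) <|
      .trans (ihp (fun t => hδ (.inr t)) _ (by rwa [SweepOp.length_run]))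
        (ihl hδ _ (by rwa [hp.length_eq, SweepOp.length_run]))
  | loop_false hb => exact pathWithin_sweep (fun t => hδ (.inl t)) hi _ o' hs hb

end Simulation

/-! ### The machine of a program -/

/-- The control states of the machine before its program starts. On the input `1 ^ N` it counts the
input symbols in binary (`ready`, `carry`, `back`) and then appends zeros (`pad`, `padBack`). -/
inductive SetupState : Type
  | begin
  | ready
  | carry
  | back
  | pad (k : Fin 4)
  | padBack
  deriving Fintype

/-- The digit vector with `b` in the component `r` and `0` elsewhere. -/
def singleDigit [DecidableEq V] (r : V) (b : Bool) : V → Bool :=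
  Function.update (fun _ => false) r b

theorem singleDigit_self [DecidableEq V] (r : V) (b : Bool) : singleDigit r b r = b :=
  Function.update_self ..

theorem update_singleDigit [DecidableEq V] (r : V) (b b' : Bool) :
    Function.update (singleDigit r b) r b' = singleDigit r b' :=
  Function.update_idem ..

/-- The machine first writes its input length in binary into the component `r`, with three leading
zeros, and then runs the program `p`. -/
def machineTrans [DecidableEq V] (r : V) (p : Prog V O) :
    SetupState ⊕ (p.State ⊕ Unit) → InputCell Unit → TapeSymbol V →
      Option ((SetupState ⊕ (p.State ⊕ Unit)) × HeadMove × TapeSymbol V × HeadMove × List O)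
  | .inl .begin, _, _ => some (.inl .ready, .right, some none, .stay, [])
  | .inl .ready, .symbol _, γ => some (.inl .carry, .stay, γ, .right, [])
  | .inl .ready, _, γ => some (.inl (.pad 3), .stay, γ, .right, [])
  | .inl .carry, _, some (some d) =>
    if d r then some (.inl .carry, .stay, some (some (Function.update d r false)), .right, [])
    else some (.inl .back, .stay, some (some (Function.update d r true)), .stay, [])
  | .inl .carry, _, _ => some (.inl .back, .stay, some (some (singleDigit r true)), .stay, [])
  | .inl .back, _, some none => some (.inl .ready, .right, some none, .stay, [])
  | .inl .back, _, γ => some (.inl .back, .stay, γ, .left, [])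
  | .inl (.pad k), _, some γ => some (.inl (.pad k), .stay, some γ, .right, [])
  | .inl (.pad ⟨0, _⟩), _, none => some (.inl .padBack, .stay, none, .left, [])
  | .inl (.pad ⟨k + 1, hk⟩), _, none =>
    some (.inl (.pad ⟨k, by omega⟩), .stay, some (some fun _ => false), .right, [])
  | .inl .padBack, _, some none => some (.inr (.inl p.first), .stay, some none, .stay, [])
  | .inl .padBack, _, γ => some (.inl .padBack, .stay, γ, .left, [])
  | .inr (.inl s), _, γ =>
    let next := p.trans (fun t => .inr (.inl t)) (.inr (.inr ())) s γ
    some (next.1, .stay, next.2)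
  | .inr (.inr _), _, _ => none

section Machine

variable [Finite V] [DecidableEq V] (r : V) (p : Prog V O)

instance : Finite (SetupState ⊕ (p.State ⊕ Unit)) :=
  have := p.finite_state
  inferInstance

/-- The machine with transition function `machineTrans r p`. -/
abbrev progMachine : Transducer Unit O :=
  singleTape (SetupState ⊕ (p.State ⊕ Unit)) (.inl .begin) (machineTrans r p)

/-- The word on the tape of the machine when the program starts. -/
def startWord (r : V) (N : ℕ) : List (V → Bool) :=
  N.bits.map (singleDigit r) ++ List.replicate 3 fun _ => false

variable {r p} {w : List Unit} {s i k : ℕ} (o : List O)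

theorem pathWithin_back_ready (hi : i ≤ w.length) (l : List (V → Bool)) {h : ℕ}
    (hh : h < s) :
    (progMachine r p).PathWithin w s (tapeConfig (.inl .back) i (tapeOf l) h o)
      (tapeConfig (.inl .ready) (i + 1) (tapeOf l) 0 o) := by
  refine pathWithin_return (mi := .right) (fun a γ hγ => ?_) rfl (by omega) (Nat.succ_le_succ hi) hh
  rcases γ with _ | _ | d
  exacts [rfl, absurd rfl hγ, rfl]

theorem pathWithin_padBack (hi : i ≤ w.length + 1) (l : List (V → Bool)) {h : ℕ} (hh : h < s) :
    (progMachine r p).PathWithin w s (tapeConfig (.inl .padBack) i (tapeOf l) h o)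
      (tapeConfig (.inr (.inl p.first)) i (tapeOf l) 0 o) := by
  refine pathWithin_return (mi := .stay) (fun a γ hγ => ?_) rfl hi hi hh
  rcases γ with _ | _ | d
  exacts [rfl, absurd rfl hγ, rfl]

theorem pathWithin_carry (hi : i ≤ w.length) (l : List (V → Bool))
    (hs : l.length + k.bits.length + 1 < s) :
    (progMachine r p).PathWithin w s
      (tapeConfig (.inl .carry) i (tapeOf (l ++ k.bits.map (singleDigit r))) (l.length + 1) o)
      (tapeConfig (.inl .ready) (i + 1) (tapeOf (l ++ (k + 1).bits.map (singleDigit r))) 0 o) := by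
  have hback : ∀ l' : List (V → Bool), (progMachine r p).PathWithin w s
      (tapeConfig (.inl .back) i (tapeOf l') (l.length + 1) o)
      (tapeConfig (.inl .ready) (i + 1) (tapeOf l') 0 o) :=
    fun l' => pathWithin_back_ready o hi l' (by omega)
  induction k using Nat.binaryRec' generalizing l with
  | zero =>
    rw [Nat.zero_bits, List.map_nil, List.append_nil, Nat.zero_add, Nat.one_bits]
    exact .trans (pathWithin_extend (mh := .stay) rfl (by omega) (by omega)) (hback _)
  | bit b j hj ih =>
    have hdigit : machineTrans r p (.inl .carry) (Transducer.readInput w i)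
        (some (some (singleDigit r b))) = some (.inl (if b then .carry else .back), .stay,
          some (some (singleDigit r !b)), if b then .right else .stay, []) := by
      cases b <;> simp [machineTrans, singleDigit_self, update_singleDigit]
    rw [Nat.bits_append_bit j b hj] at hs ⊢
    rw [List.length_cons] at hs
    refine .trans (pathWithin_overwrite hdigit (by omega) (by omega)) ?_
    cases b with
    | false =>
      rw [show Nat.bit false j + 1 = Nat.bit true j from rfl, Nat.bits_append_bit j true (by simp)]
      simpa [HeadMove.apply] using hback (l ++ singleDigit r true :: j.bits.map (singleDigit r))
    | true =>
      rw [show Nat.bit true j + 1 = Nat.bit false (j + 1) by simp [Nat.bit]; ring,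
        Nat.bits_append_bit _ false (by simp)]
      simpa [HeadMove.apply] using ih (l ++ [singleDigit r false]) (by simp; omega)
        fun l' => pathWithin_back_ready o hi l' (by simp; omega)

theorem pathWithin_count (hk : k < w.length) (hs : k.bits.length + 1 < s) :
    (progMachine r p).PathWithin w s
      (tapeConfig (.inl .ready) (k + 1) (tapeOf (k.bits.map (singleDigit r))) 0 o)
      (tapeConfig (.inl .ready) (k + 1 + 1) (tapeOf ((k + 1).bits.map (singleDigit r))) 0 o) :=
  .trans
    (pathWithin_move (mi := .stay) (mh := .right) (by rw [Transducer.readInput_of_lt hk]; rfl)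
      (Nat.succ_le_succ hk.le) (by omega))
    (pathWithin_carry o (Nat.succ_le_of_lt hk) [] (by simpa using hs))

theorem pathWithin_countAll (hk : k ≤ w.length) (hs : w.length.bits.length + 1 < s) :
    (progMachine r p).PathWithin w s
      (tapeConfig (.inl .ready) 1 (tapeOf []) 0 o)
      (tapeConfig (.inl .ready) (k + 1) (tapeOf (k.bits.map (singleDigit r))) 0 o) := by
  induction k with
  | zero => exact Relation.ReflTransGen.refl
  | succ k ih =>
    refine (ih (by omega)).trans (pathWithin_count o (by omega) ?_)
    have : k.size ≤ w.length.size := Nat.size_le_size (by omega)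
    rw [Nat.size_eq_bits_len] at hs ⊢
    omega

theorem pathWithin_padScan (hi : i ≤ w.length + 1) (l l' : List (V → Bool)) (k : Fin 4)
    (hs : l.length + l'.length + 1 < s) :
    (progMachine r p).PathWithin w s
      (tapeConfig (.inl (.pad k)) i (tapeOf (l ++ l')) (l.length + 1) o)
      (tapeConfig (.inl (.pad k)) i (tapeOf (l ++ l')) ((l ++ l').length + 1) o) := by
  induction l' generalizing l with
  | nil => rw [List.append_nil]; exact Relation.ReflTransGen.refl
  | cons d l' ih =>
    refine .trans (pathWithin_move (mi := .stay) (mh := .right)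
      (by rw [tapeOf_append_cons]; rfl) hi (by omega)) ?_
    simpa [HeadMove.apply] using ih (l ++ [d]) (by grind)

theorem pathWithin_pad (hi : i ≤ w.length + 1) (hk : k < 4) (l : List (V → Bool))
    (hs : l.length + k + 1 < s) :
    (progMachine r p).PathWithin w s
      (tapeConfig (.inl (.pad ⟨k, hk⟩)) i (tapeOf l) (l.length + 1) o)
      (tapeConfig (.inr (.inl p.first)) i (tapeOf (l ++ List.replicate k fun _ => false)) 0 o) := by
  induction k generalizing l with
  | zero =>
    rw [List.replicate_zero, List.append_nil]
    exact .trans (pathWithin_move (mi := .stay) (mh := .left) (by rw [tapeOf_length]; rfl) hi hs)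
      (pathWithin_padBack o hi l (Nat.lt_of_succ_lt hs))
  | succ k ih =>
    refine .trans (pathWithin_extend (mh := .right) rfl hi (by omega)) ?_
    have hpad := ih (by omega) (l ++ [fun _ => false]) (by grind)
    rwa [List.length_append, List.append_assoc] at hpad

theorem pathWithin_startWord (hs : w.length.bits.length + 4 < s) :
    (progMachine r p).PathWithin w s (progMachine r p).init
      (tapeConfig (.inr (.inl p.first)) (w.length + 1) (tapeOf (startWord r w.length)) 0 []) := by
  have hbegin := pathWithin_step (start := .inl .begin) (δ := machineTrans r p) (w := w) (s := s)
    (q := .inl .begin) (i := 0) (T := fun _ => none) (h := 0) (o := []) rfl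
    (Nat.succ_le_succ (Nat.zero_le _)) (by omega)
  rw [update_blank_eq_tapeOf_nil] at hbegin
  have hscan := pathWithin_padScan (r := r) (p := p) (s := s) [] (le_refl (w.length + 1)) []
    (w.length.bits.map (singleDigit r)) 3 (by simp; omega)
  rw [List.nil_append] at hscan
  exact .trans hbegin <| .trans (pathWithin_countAll [] le_rfl (by omega)) <|
    .trans (pathWithin_move (mi := .stay) (mh := .right)
      (by rw [Transducer.readInput_length_succ]; rfl) le_rfl (by omega)) <|
    .trans hscan <| pathWithin_pad [] le_rfl (by omega) _ (by simpa using hs)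

theorem progMachine_outputsInSpace {o : List O} {N : ℕ} {l : List (V → Bool)}
    (h : p.Exec (startWord r N) l o) :
    (progMachine r p).OutputsInSpace (List.replicate N ()) o (6 * (Nat.log 2 N + 1)) := by
  have hN : N.bits.length ≤ Nat.log 2 N + 1 := by
    rw [Nat.size_eq_bits_len, Nat.size_le]
    exact Nat.lt_pow_succ_log_self one_lt_two N
  have hsetup := pathWithin_startWord (r := r) (p := p) (w := List.replicate N ())
    (s := 6 * (Nat.log 2 N + 1)) (by rw [List.length_replicate]; omega)
  rw [List.length_replicate] at hsetup
  have hrun := h.pathWithin (start := .inl .begin) (δ := machineTrans r p)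
    (w := List.replicate N ()) (s := 6 * (Nat.log 2 N + 1)) (i := N + 1)
    (e := fun t => .inr (.inl t)) (k := .inr (.inr ())) (fun _ _ _ => rfl) (by simp) []
    (by simp [startWord]; omega)
  exact Transducer.outputsInSpace_of_pathWithin (M := progMachine r p) (hsetup.trans hrun) rfl
    (fun _ => show 0 < 6 * (Nat.log 2 N + 1) by omega)

end Machine

end Sweep

/-! ### Arithmetic by passes over binary numbers -/

section DigitVecs

theorem digitVecs_eq_map_testBit {ι : Type*} (W : ℕ) (v : ι → ℕ) :
    digitVecs W v = (List.range W).map fun i x => (v x).testBit i := by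
  induction W generalizing v with
  | zero => rfl
  | succ W ih =>
    rw [digitVecs, ih, List.range_succ_eq_map, List.map_cons, List.map_map]
    simp only [Nat.testBit_zero, Function.comp_def, Nat.testBit_succ]

theorem map_comp_digitVecs {ι κ : Type*} (g : κ → ι) (W : ℕ) (v : ι → ℕ) :
    (digitVecs W v).map (fun d => d ∘ g) = digitVecs W (v ∘ g) := by
  simp only [digitVecs_eq_map_testBit, List.map_map]
  rfl

theorem bits_eq_map_testBit (n : ℕ) : n.bits = (List.range n.size).map n.testBit := by
  refine List.ext_getElem (by simp [Nat.size_eq_bits_len]) fun i hi _ => ?_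
  rw [List.getElem_map, List.getElem_range, Nat.testBit_eq_inth, List.getI_eq_getElem _ hi]

theorem startWord_eq_digitVecs {V : Type} [DecidableEq V] (r : V) (N : ℕ) :
    startWord r N = digitVecs (labelWidth N) (Function.update (0 : V → ℕ) r N) := by
  have digits_eq : (fun i x => (Function.update (0 : V → ℕ) r N x).testBit i) =
      fun i => singleDigit r (N.testBit i) := by
    funext i x
    by_cases hx : x = r
    · subst hx
      simp [singleDigit]
    · simp [singleDigit, hx]
  have testBit_size_add (i : ℕ) : N.testBit (N.size + i) = false :=
    Nat.testBit_lt_two_pow (Nat.size_le.1 (Nat.le_add_right _ _))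
  rw [digitVecs_eq_map_testBit, digits_eq]
  simp only [startWord, bits_eq_map_testBit, labelWidth, List.range_add, List.map_append,
    List.map_map, Function.comp_def, testBit_size_add]
  congr 1
  simp [singleDigit]

theorem flatMap_range_ite_eq {β : Type*} (f : ℕ → β) {W i : ℕ} (hi : i < W) :
    ((List.range W).flatMap fun j => if i = j then [f j] else []) = [f i] := by
  induction W with
  | zero => omega
  | succ W ih =>
    rw [List.range_succ, List.flatMap_append]
    rcases Nat.lt_succ_iff_lt_or_eq.1 hi with hi | rfl
    · rw [ih hi]
      simp [hi.ne]
    · have prefix_eq_nil :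
          ((List.range i).flatMap fun j => if i = j then [f j] else []) = [] := by
        simpa [List.flatMap_eq_nil_iff] using fun j hj => hj.ne'
      simp [prefix_eq_nil]

end DigitVecs

namespace SweepOp

variable {V O : Type}

/-- A pass that leaves the word unchanged and updates its memory bit by the digits of `x` and `y`;
it decides a relation between the numbers `x` and `y`. -/
def test (b : Bool) (f : Bool → Bool → Bool → Bool) (x y : V) : SweepOp V O :=
  ⟨b, fun b d => (f b (d x) (d y), d, [])⟩

/-- A pass that leaves the word unchanged and writes `f d` for every digit vector `d`. -/
def write (f : (V → Bool) → List O) : SweepOp V O :=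
  ⟨false, fun b d => (b, d, f d)⟩

/-- A pass that replaces `x` by a function of `x` and `y`: from the carry and the digits of `x` and
`y`, the function `f` computes the next carry and the new digit of `x`. -/
def assign [DecidableEq V] (b : Bool) (f : Bool → Bool → Bool → Bool × Bool) (x y : V) :
    SweepOp V O :=
  ⟨b, fun b d => ((f b (d x) (d y)).1, Function.update d x (f b (d x) (d y)).2, [])⟩

/-- In this word with numbers of `W` digits, the pass only decides whether `b` holds. -/
def Decides (M : SweepOp V O) (W : ℕ) (v : V → ℕ) (b : Bool) : Prop :=
  M.run M.start (digitVecs W v) = (b, digitVecs W v, [])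

theorem decides_test {b : Bool} {f : Bool → Bool → Bool → Bool} {r : Bool → ℕ → ℕ → Bool}
    (zero : ∀ b, r b 0 0 = b)
    (half : ∀ b i j, r (f b (decide (i % 2 = 1)) (decide (j % 2 = 1))) (i / 2) (j / 2) = r b i j)
    {W : ℕ} {x y : V} {v : V → ℕ} (hx : v x < 2 ^ W) (hy : v y < 2 ^ W) :
    (test b f x y : SweepOp V O).Decides W v (r b (v x) (v y)) := by
  suffices run_eq : ∀ b', (test b f x y : SweepOp V O).run b' (digitVecs W v) =
      (r b' (v x) (v y), digitVecs W v, []) from run_eq b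
  intro b'
  induction W generalizing v b' with
  | zero =>
    rw [Nat.lt_one_iff.1 hx, Nat.lt_one_iff.1 hy, zero]
    rfl
  | succ W ih =>
    rw [pow_succ] at hx hy
    have ih := ih (v := fun x => v x / 2) (by omega) (by omega)
    simp only [test] at ih
    simp only [digitVecs, run, test, ih, half, List.nil_append]

theorem run_write (f : (V → Bool) → List O) (b : Bool) (l : List (V → Bool)) :
    (write f).run b l = (b, l, l.flatMap f) := by
  induction l with
  | nil => rfl
  | cons d l ih =>
    simp only [write] at ih
    simp only [run, write, ih, List.flatMap_cons]

variable [DecidableEq V]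

theorem digitVecs_succ_update (W : ℕ) (v : V → ℕ) (x : V) (k : ℕ) :
    digitVecs (W + 1) (Function.update v x k) =
      Function.update (fun y => decide (v y % 2 = 1)) x (decide (k % 2 = 1)) ::
        digitVecs W (Function.update (fun y => v y / 2) x (k / 2)) := by
  rw [digitVecs]
  congr 2 <;> funext y <;> by_cases h : y = x <;> simp [h]

theorem run_assign {b : Bool} {f : Bool → Bool → Bool → Bool × Bool} {g : Bool → ℕ → ℕ → ℕ}
    (digit : ∀ b i j,
      (f b (decide (i % 2 = 1)) (decide (j % 2 = 1))).2 = decide (g b i j % 2 = 1))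
    (carry : ∀ b i j,
      g (f b (decide (i % 2 = 1)) (decide (j % 2 = 1))).1 (i / 2) (j / 2) = g b i j / 2)
    {W : ℕ} {x y : V} {v : V → ℕ} (b' : Bool) :
    ((assign b f x y : SweepOp V O).run b' (digitVecs W v)).2 =
      (digitVecs W (Function.update v x (g b' (v x) (v y))), []) := by
  induction W generalizing v b' with
  | zero => rfl
  | succ W ih =>
    have ih := @ih fun x => v x / 2
    simp only [assign] at ih
    rw [digitVecs_succ_update]
    simp only [run, digitVecs, assign, ih, digit, carry, List.nil_append]

def zero (x : V) : SweepOp V O :=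
  assign false (fun _ _ _ => (false, false)) x x

def copy (x y : V) : SweepOp V O :=
  assign false (fun b _ j => (b, j)) x y

def add (x y : V) : SweepOp V O :=
  assign false (fun b i j => (b && i || b && j || i && j, b ^^ (i ^^ j))) x y

def inc (x : V) : SweepOp V O :=
  assign true (fun b i _ => (b && i, b ^^ i)) x x

theorem run_zero (W : ℕ) (x : V) (v : V → ℕ) :
    ((zero x : SweepOp V O).run false (digitVecs W v)).2 =
      (digitVecs W (Function.update v x 0), []) :=
  run_assign (g := fun _ _ _ => 0) (by simp) (by simp) false

theorem run_copy (W : ℕ) (x y : V) (v : V → ℕ) :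
    ((copy x y : SweepOp V O).run false (digitVecs W v)).2 =
      (digitVecs W (Function.update v x (v y)), []) :=
  run_assign (g := fun _ _ j => j) (by simp) (by simp) false

theorem run_add (W : ℕ) (x y : V) (v : V → ℕ) :
    ((add x y : SweepOp V O).run false (digitVecs W v)).2 =
      (digitVecs W (Function.update v x (v x + v y)), []) := by
  refine run_assign (g := fun b i j => i + j + b.toNat) (fun b i j => ?_) (fun b i j => ?_) false
  all_goals
    rcases Nat.mod_two_eq_zero_or_one i with hi | hi <;>
    rcases Nat.mod_two_eq_zero_or_one j with hj | hj <;>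
    cases b <;> simp [hi, hj, Nat.add_mod] <;> omega

theorem run_inc (W : ℕ) (x : V) (v : V → ℕ) :
    ((inc x : SweepOp V O).run true (digitVecs W v)).2 =
      (digitVecs W (Function.update v x (v x + 1)), []) := by
  refine run_assign (g := fun b i _ => i + b.toNat) (fun b i _ => ?_) (fun b i _ => ?_) true
  all_goals
    rcases Nat.mod_two_eq_zero_or_one i with hi | hi <;>
    cases b <;> simp [hi, Nat.add_mod] <;> omega

end SweepOp

namespace SweepOp

variable {V O : Type} {W : ℕ} {x y : V} {v : V → ℕ}

/-- The memory bit is the comparison of the digits read so far, equality counting as `b`. -/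
def compare (b : Bool) (x y : V) : SweepOp V O :=
  test b (fun b i j => if i = j then b else j) x y

def lt (x y : V) : SweepOp V O :=
  compare false x y

def le (x y : V) : SweepOp V O :=
  compare true x y

def eq (x y : V) : SweepOp V O :=
  test true (fun b i j => b && i == j) x y

/-- Decides whether `x` and `y` have a common binary digit `1`. -/
def meet (x y : V) : SweepOp V O :=
  test false (fun b i j => b || i && j) x y

theorem decides_compare (b : Bool) (hx : v x < 2 ^ W) (hy : v y < 2 ^ W) :
    (compare b x y : SweepOp V O).Decides W v (decide (v x < v y + b.toNat)) := by
  refine decides_test (r := fun b i j => decide (i < j + b.toNat)) (by simp) (fun b i j => ?_) hx hy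
  rcases Nat.mod_two_eq_zero_or_one i with hi | hi <;>
    rcases Nat.mod_two_eq_zero_or_one j with hj | hj <;>
    cases b <;> simp [hi, hj] <;> omega

theorem decides_lt (hx : v x < 2 ^ W) (hy : v y < 2 ^ W) :
    (lt x y : SweepOp V O).Decides W v (decide (v x < v y)) :=
  decides_compare false hx hy

theorem decides_le (hx : v x < 2 ^ W) (hy : v y < 2 ^ W) :
    (le x y : SweepOp V O).Decides W v (decide (v x ≤ v y)) := by
  simpa only [le, Bool.toNat_true, Nat.lt_succ_iff] using decides_compare (O := O) true hx hy

theorem decides_eq (hx : v x < 2 ^ W) (hy : v y < 2 ^ W) :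
    (eq x y : SweepOp V O).Decides W v (decide (v x = v y)) := by
  refine decides_test (r := fun b i j => b && decide (i = j)) (by simp) (fun b i j => ?_) hx hy
  rcases Nat.mod_two_eq_zero_or_one i with hi | hi <;>
    rcases Nat.mod_two_eq_zero_or_one j with hj | hj <;>
    cases b <;> simp [hi, hj] <;> omega

theorem decides_meet (hx : v x < 2 ^ W) (hy : v y < 2 ^ W) :
    (meet x y : SweepOp V O).Decides W v (decide (v x &&& v y ≠ 0)) := by
  refine decides_test (r := fun b i j => b || decide (i &&& j ≠ 0)) (by simp)
    (fun b i j => ?_) hx hy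
  have half := Nat.and_div_two (a := i) (b := j)
  have parity := Nat.and_mod_two_eq_one (a := i) (b := j)
  rw [← half, Bool.or_assoc, Bool.eq_iff_iff]
  simp only [Bool.or_eq_true, Bool.and_eq_true, decide_eq_true_eq, ← parity]
  refine or_congr_right ?_
  omega

/-- Writes the digits of `x` at the positions of the digits `1` of `y`. -/
def writeAt (f : Bool → O) (x y : V) : SweepOp V O :=
  write fun d => if d y then [f (d x)] else []

theorem run_writeAt (f : Bool → O) (b : Bool) {i : ℕ} (hi : i < W) (hy : v y = 2 ^ i) :
    (writeAt f x y).run b (digitVecs W v) = (b, digitVecs W v, [f ((v x).testBit i)]) := by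
  rw [writeAt, run_write, digitVecs_eq_map_testBit, List.flatMap_map]
  simp only [hy, Nat.testBit_two_pow, decide_eq_true_eq]
  rw [flatMap_range_ite_eq (fun j => f ((v x).testBit j)) hi]

end SweepOp

/-! ### Programs over registers -/

namespace Prog

variable {V O : Type}

/-- The program turns the register contents `v` into `v'`, with numbers of `W` binary digits. -/
def Runs (p : Prog V O) (W : ℕ) (v v' : V → ℕ) (o : List O) : Prop :=
  p.Exec (digitVecs W v) (digitVecs W v') o

/-- The program writes `o` and restores the register contents. -/
abbrev Prints (p : Prog V O) (W : ℕ) (v : V → ℕ) (o : List O) : Prop :=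
  p.Runs W v v o

namespace Runs

variable {W : ℕ} {p q : Prog V O} {v v' v'' : V → ℕ} {o o' : List O} {M : SweepOp V O}

theorem emit (w : List O) (v : V → ℕ) : (Prog.emit w).Prints W v w :=
  Exec.emit w _

theorem seq (hp : p.Runs W v v' o) (hq : q.Runs W v' v'' o') :
    (Prog.seq p q).Runs W v v'' (o ++ o') :=
  Exec.seq hp hq

theorem seq_silent (hp : p.Runs W v v' o) (hq : q.Runs W v' v'' []) :
    (Prog.seq p q).Runs W v v'' o := by
  simpa only [List.append_nil] using hp.seq hq

theorem op (h : (M.run M.start (digitVecs W v)).2 = (digitVecs W v', o)) :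
    (Prog.op M).Runs W v v' o := by
  have hexec := Exec.op M (digitVecs W v)
  rwa [h] at hexec

theorem ite {b : Bool} (hM : M.Decides W v b) (hp : b = true → p.Runs W v v' o)
    (hq : b = false → q.Runs W v v' o) : (Prog.ite M p q).Runs W v v' o := by
  cases b with
  | true =>
    have hexec := Exec.ite_true (M := M) (p := p) (q := q) (l := digitVecs W v) (by rw [hM])
      (by rw [hM]; exact hp rfl)
    rwa [hM] at hexec
  | false =>
    have hexec := Exec.ite_false (M := M) (p := p) (q := q) (l := digitVecs W v) (by rw [hM])
      (by rw [hM]; exact hq rfl)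
    rwa [hM] at hexec

theorem loop {n : ℕ} {s : ℕ → V → ℕ} {out : ℕ → List O}
    (hM : ∀ i ≤ n, M.Decides W (s i) (decide (i < n)))
    (hp : ∀ i < n, p.Runs W (s i) (s (i + 1)) (out i)) :
    (Prog.loop M p).Runs W (s 0) (s n) ((List.range n).flatMap out) := by
  induction n generalizing s out with
  | zero =>
    have hM := hM 0 le_rfl
    have hexec := Exec.loop_false (M := M) (p := p) (l := digitVecs W (s 0)) (by rw [hM]; rfl)
    rwa [hM] at hexec
  | succ n ih =>
    have hrest := ih (s := fun i => s (i + 1)) (out := fun i => out (i + 1))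
      (fun i hi => by simpa using hM (i + 1) (Nat.succ_le_succ hi))
      (fun i hi => hp (i + 1) (Nat.succ_lt_succ hi))
    have hM := hM 0 (Nat.zero_le _)
    have hbody : p.Exec (M.run M.start (digitVecs W (s 0))).2.1 (digitVecs W (s 1)) (out 0) := by
      rw [hM]
      exact hp 0 n.succ_pos
    have hexec := Exec.loop_true (M := M) (by rw [hM]; simp) hbody hrest
    rw [hM] at hexec
    rw [List.range_succ_eq_map, List.flatMap_cons, List.flatMap_map]
    exact hexec

theorem loop_silent {n : ℕ} {s : ℕ → V → ℕ}
    (hM : ∀ i ≤ n, M.Decides W (s i) (decide (i < n)))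
    (hp : ∀ i < n, p.Runs W (s i) (s (i + 1)) []) :
    (Prog.loop M p).Runs W (s 0) (s n) [] := by
  simpa only [List.flatMap_eq_nil_iff.2 fun _ _ => rfl] using loop hM hp

section

variable [DecidableEq V] {x y : V}

theorem zero (h : Function.update v x 0 = v') :
    (Prog.op (SweepOp.zero x) : Prog V O).Runs W v v' [] :=
  op (h ▸ SweepOp.run_zero W x v)

theorem copy (h : Function.update v x (v y) = v') :
    (Prog.op (SweepOp.copy x y) : Prog V O).Runs W v v' [] :=
  op (h ▸ SweepOp.run_copy W x y v)

theorem inc (h : Function.update v x (v x + 1) = v') :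
    (Prog.op (SweepOp.inc x) : Prog V O).Runs W v v' [] :=
  op (h ▸ SweepOp.run_inc W x v)

theorem add (h : Function.update v x (v x + v y) = v') :
    (Prog.op (SweepOp.add x y) : Prog V O).Runs W v v' [] :=
  op (h ▸ SweepOp.run_add W x y v)

end

theorem write (f : (V → Bool) → List O) (v : V → ℕ) :
    (Prog.op (SweepOp.write f)).Prints W v ((digitVecs W v).flatMap f) :=
  op (congrArg Prod.snd (SweepOp.run_write f _ _))

theorem writeAt (f : Bool → O) {x y : V} {i : ℕ} (hi : i < W) (hy : v y = 2 ^ i) :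
    (Prog.op (SweepOp.writeAt f x y)).Prints W v [f ((v x).testBit i)] :=
  op (congrArg Prod.snd (SweepOp.run_writeAt f _ hi hy))

end Runs

end Prog

/-! ### Printing the circuit of a formula -/

/-- The registers of a program: one for every variable, one for the number of input bits, one for
the number of vertices, and three for auxiliary numbers. -/
inductive Reg (c : ℕ) : Type
  | var (x : Fin c)
  | input
  | vertices
  | index
  | count
  | power
  deriving DecidableEq, Fintype

/-- Programs that print a circuit. -/
abbrev RegProg (c : ℕ) : Type :=
  Prog (Reg c) CircuitSymbol

namespace RegProg

open Prog

variable {c W : ℕ} {v : Reg c → ℕ} {p : RegProg c}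

/-- Runs `p` for all values of the variable `x`. -/
def forVar (x : Fin c) (p : RegProg c) : RegProg c :=
  .seq (.loop (.lt (.var x) .vertices) (.seq p (.op (.inc (.var x))))) (.op (.zero (.var x)))

theorem prints_forVar {x : Fin c} (hx : v (.var x) = 0) (hW : v .vertices < 2 ^ W)
    {out : ℕ → List CircuitSymbol}
    (hp : ∀ i < v .vertices, p.Prints W (Function.update v (.var x) i) (out i)) :
    (forVar x p).Prints W v ((List.range (v .vertices)).flatMap out) := by
  have hloop := Runs.loop (W := W) (M := .lt (.var x) .vertices)
    (p := .seq p (.op (.inc (.var x)))) (s := Function.update v (.var x)) (out := out)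
    (fun i hi => by
      simpa using SweepOp.decides_lt (O := CircuitSymbol) (W := W) (x := .var x) (y := .vertices)
        (v := Function.update v (.var x) i) (by simpa using hi.trans_lt hW) (by simpa using hW))
    (fun i hi => (hp i hi).seq_silent (Runs.inc (by simp)))
  have hinit : Function.update v (.var x) 0 = v := Function.update_eq_self_iff.2 hx.symm
  rw [hinit] at hloop
  exact hloop.seq_silent (Runs.zero (by rw [Function.update_idem, hinit]))

/-- Runs `p` for all values of the variable `x` and restores `x` afterwards. -/
def forVarRestoring (x : Fin c) (p : RegProg c) : RegProg c :=
  .seq (.op (.copy .count (.var x))) (.seq (.op (.zero (.var x))) (.seq (forVar x p)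
    (.seq (.op (.copy (.var x) .count)) (.op (.zero .count)))))

theorem prints_forVarRestoring {x : Fin c} (hcount : v .count = 0) (hW : v .vertices < 2 ^ W)
    {out : ℕ → List CircuitSymbol}
    (hp : ∀ i < v .vertices, p.Prints W
      (Function.update (Function.update v .count (v (.var x))) (.var x) i) (out i)) :
    (forVarRestoring x p).Prints W v ((List.range (v .vertices)).flatMap out) := by
  have hfor := prints_forVar (W := W) (p := p) (x := x) (out := out)
    (v := Function.update (Function.update v .count (v (.var x))) (.var x) 0) (by simp)
    (by simpa using hW) (by simpa using hp)
  rw [Function.update_of_ne (by simp), Function.update_of_ne (by simp)] at hfor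
  refine (Runs.copy rfl).seq ((Runs.zero ?_).seq (hfor.seq_silent
    ((Runs.copy rfl).seq (Runs.zero ?_))))
  · rfl
  · funext r
    cases r <;> grind [Function.update_apply]

/-- Runs `p` for all values of the variables of a list. -/
def forAssignments : List (Fin c) → RegProg c → RegProg c
  | [], p => p
  | x :: xs, p => forVar x (forAssignments xs p)

/-- Runs `p` for all powers of two below the number of vertices as values of the variable `z`. -/
def forPowers (z : Fin c) (p : RegProg c) : RegProg c :=
  .seq (.op (.inc (.var z))) (.seq (.loop (.lt (.var z) .vertices)
    (.seq p (.op (.add (.var z) (.var z))))) (.op (.zero (.var z))))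

theorem prints_forPowers {z : Fin c} (hz : v (.var z) = 0)
    (hm : v .vertices < 2 ^ W) (hW : Nat.clog 2 (v .vertices) < W) {out : ℕ → List CircuitSymbol}
    (hp : ∀ b < Nat.clog 2 (v .vertices), p.Prints W (Function.update v (.var z) (2 ^ b)) (out b)) :
    (forPowers z p).Prints W v ((List.range (Nat.clog 2 (v .vertices))).flatMap out) := by
  have hloop := Runs.loop (W := W) (M := .lt (.var z) .vertices)
    (p := .seq p (.op (.add (.var z) (.var z))))
    (s := fun b => Function.update v (.var z) (2 ^ b)) (out := out)
    (fun b hb => by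
      simpa [Nat.lt_clog_iff_pow_lt] using SweepOp.decides_lt (O := CircuitSymbol) (W := W)
        (x := .var z) (y := .vertices) (v := Function.update v (.var z) (2 ^ b))
        (by simpa using Nat.pow_lt_pow_right one_lt_two (hb.trans_lt hW)) (by simpa using hm))
    (fun b hb => (hp b hb).seq_silent (Runs.add (by simp [pow_succ, mul_two])))
  refine (Runs.inc (by simp [hz])).seq (hloop.seq_silent (Runs.zero ?_))
  rw [Function.update_idem, Function.update_eq_self_iff]
  exact hz.symm

/-- Writes the binary digits of the register `index` and sets it to `0`. -/
def emitIndex : RegProg c :=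
  .seq (.op (.inc .power))
    (.seq (.loop (.le .power .index)
      (.seq (.op (.writeAt CircuitSymbol.bit .index .power)) (.op (.add .power .power))))
      (.seq (.op (.zero .power)) (.op (.zero .index))))

theorem runs_emitIndex (hpower : v .power = 0) (hW : (v .index).size < W) :
    (emitIndex : RegProg c).Runs W v (Function.update v .index 0) ((v .index).bits.map .bit) := by
  have hloop := Runs.loop (W := W) (M := .le .power .index)
    (p := .seq (.op (.writeAt CircuitSymbol.bit .index .power)) (.op (.add .power .power)))
    (s := fun i => Function.update v .power (2 ^ i)) (out := fun i => [.bit ((v .index).testBit i)])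
    (fun i hi => by
      simpa [← Nat.lt_size] using SweepOp.decides_le (O := CircuitSymbol) (W := W)
        (x := .power) (y := .index) (v := Function.update v .power (2 ^ i))
        (by simpa using Nat.pow_lt_pow_right one_lt_two (hi.trans_lt hW))
        (by simpa using Nat.size_le.1 hW.le))
    (fun i hi => by
      simpa using (Runs.writeAt (v := Function.update v .power (2 ^ i)) (x := .index) (y := .power)
        CircuitSymbol.bit (hi.trans hW) (by simp)).seq_silent
        (Runs.add (by simp [pow_succ, mul_two])))
  rw [bits_eq_map_testBit, List.map_map, List.map_eq_flatMap]
  refine (Runs.inc (by simp [hpower])).seq (hloop.seq_silent ((Runs.zero rfl).seq (Runs.zero ?_)))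
  funext r
  cases r <;> grind [Function.update_apply]

/-- Sets the register `index` to the position of the pair `(x, y)` in the adjacency matrix. -/
def computeIndex (x y : Fin c) : RegProg c :=
  .seq (.loop (.lt .count (.var x)) (.seq (.op (.add .index .vertices)) (.op (.inc .count))))
    (.seq (.op (.zero .count)) (.op (.add .index (.var y))))

theorem runs_computeIndex (hindex : v .index = 0) (hcount : v .count = 0) {x : Fin c}
    (hx : v (.var x) < 2 ^ W) (y : Fin c) : (computeIndex x y).Runs W v
      (Function.update v .index (v (.var x) * v .vertices + v (.var y))) [] := by
  have hloop := Runs.loop_silent (W := W) (M := .lt .count (.var x))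
    (p := .seq (.op (.add .index .vertices)) (.op (.inc .count)))
    (s := fun i => Function.update (Function.update v .index (i * v .vertices)) .count i)
    (fun i hi => by
      simpa using SweepOp.decides_lt (O := CircuitSymbol) (W := W) (x := .count) (y := .var x)
        (v := Function.update (Function.update v .index (i * v .vertices)) .count i)
        (by simpa using hi.trans_lt hx) (by simpa using hx))
    (fun _ _ => (Runs.add rfl).seq (Runs.inc (by
      funext r
      cases r <;> grind [Function.update_apply])))
  have hinit : Function.update (Function.update v .index (0 * v .vertices)) .count 0 = v := by
    funext r
    cases r <;> grind [Function.update_apply]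
  rw [hinit] at hloop
  refine hloop.seq ((Runs.zero rfl).seq (Runs.add ?_))
  funext r
  cases r <;> grind [Function.update_apply]

/-- Sets the register `vertices` to the integer square root of `input`; the register `index` runs
through `(i + 1) ^ 2 - 1`. -/
def computeSqrt : RegProg c :=
  .seq (.loop (.lt .index .input) (.seq (.op (.inc .vertices))
    (.seq (.op (.add .index .vertices)) (.seq (.op (.add .index .vertices)) (.op (.inc .index))))))
    (.op (.zero .index))

theorem runs_computeSqrt (hindex : v .index = 0) (hvertices : v .vertices = 0)
    (hW : 8 * v .input < 2 ^ W) :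
    (computeSqrt : RegProg c).Runs W v (Function.update v .vertices (v .input).sqrt) [] := by
  have hloop := Runs.loop_silent (W := W) (M := .lt .index .input)
    (p := .seq (.op (.inc .vertices)) (.seq (.op (.add .index .vertices))
      (.seq (.op (.add .index .vertices)) (.op (.inc .index)))))
    (s := fun i => Function.update (Function.update v .vertices i) .index (i * i + 2 * i))
    (n := (v .input).sqrt)
    (fun i hi => by
      have root_sq := Nat.sqrt_le (v .input)
      have root_le := Nat.sqrt_le_self (v .input)
      have index_le := Nat.mul_le_mul hi hi
      have lt_sqrt_iff : i < (v .input).sqrt ↔ i * i + 2 * i < v .input := by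
        rw [← Nat.succ_le_iff, Nat.le_sqrt, ← Nat.succ_le_iff (n := v .input)]
        exact iff_of_eq (congrArg (· ≤ v .input) (by simp only [Nat.succ_eq_add_one]; ring))
      simpa [lt_sqrt_iff] using SweepOp.decides_lt (O := CircuitSymbol) (W := W) (x := .index)
        (y := .input)
        (v := Function.update (Function.update v .vertices i) .index (i * i + 2 * i))
        (by rw [Function.update_self]; omega)
        (by simp only [ne_eq, reduceCtorEq, not_false_eq_true, Function.update_of_ne]; omega))
    (fun _ _ => (Runs.inc rfl).seq ((Runs.add rfl).seq ((Runs.add rfl).seq (Runs.inc (by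
      funext r
      cases r <;> grind [Function.update_apply])))))
  have hinit : Function.update (Function.update v .vertices 0) .index (0 * 0 + 2 * 0) = v := by
    funext r
    cases r <;> grind [Function.update_apply]
  rw [hinit] at hloop
  refine hloop.seq (Runs.zero ?_)
  funext r
  cases r <;> grind [Function.update_apply]

end RegProg

section Programs

open Prog

variable {c N : ℕ}

/-- The register contents between the parts of the program that prints a circuit. -/
def baseStore (N : ℕ) (a : Fin c → ℕ) : Reg c → ℕ
  | .var x => a x
  | .input => N
  | .vertices => N.sqrt
  | .index => 0
  | .count => 0
  | .power => 0

/-- The initial register contents. -/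
def inputStore (N : ℕ) : Reg c → ℕ :=
  Function.update 0 .input N

theorem update_baseStore_var (a : Fin c → ℕ) (x : Fin c) (i : ℕ) :
    Function.update (baseStore N a) (.var x) i = baseStore N (Function.update a x i) := by
  funext r
  cases r <;> simp [baseStore, Function.update_apply]

theorem baseStore_lt_two_pow_labelWidth {a : Fin c → ℕ} (ha : ∀ x, a x < N.sqrt) (r : Reg c) :
    baseStore N a r < 2 ^ labelWidth N := by
  have sqrt_lt := sqrt_lt_two_pow_labelWidth N
  cases r with
  | var x => exact (ha x).trans sqrt_lt
  | input => exact lt_two_pow_labelWidth N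
  | vertices => exact sqrt_lt
  | _ => exact pow_pos two_pos _

namespace RegProg

variable {a : Fin c → ℕ} {p : RegProg c}

theorem prints_forVar_baseStore {x : Fin c} (hx : a x = 0) {out : ℕ → List CircuitSymbol}
    (hp : ∀ i < N.sqrt,
      p.Prints (labelWidth N) (baseStore N (Function.update a x i)) (out i)) :
    (forVar x p).Prints (labelWidth N) (baseStore N a) ((List.range N.sqrt).flatMap out) :=
  prints_forVar hx (sqrt_lt_two_pow_labelWidth N) fun i hi => by
    rw [update_baseStore_var]
    exact hp i hi

theorem prints_forAssignments {xs : List (Fin c)} (hxs : xs.Nodup) (ha : ∀ x ∈ xs, a x = 0)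
    {out : (Fin c → ℕ) → List CircuitSymbol}
    (hp : ∀ b ∈ assignments N.sqrt xs a, p.Prints (labelWidth N) (baseStore N b) (out b)) :
    (forAssignments xs p).Prints (labelWidth N) (baseStore N a)
      ((assignments N.sqrt xs a).flatMap out) := by
  induction xs generalizing a with
  | nil => simpa [assignments, forAssignments] using hp a (by simp [assignments])
  | cons x xs ih =>
    obtain ⟨hx, hxs⟩ := List.nodup_cons.1 hxs
    rw [assignments, List.flatMap_assoc]
    refine prints_forVar_baseStore (ha x List.mem_cons_self) fun i hi => ih hxs ?_ fun b hb => ?_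
    · intro y hy
      rw [Function.update_of_ne (ne_of_mem_of_not_mem hy hx)]
      exact ha y (List.mem_cons_of_mem x hy)
    · exact hp b (List.mem_flatMap.2 ⟨i, List.mem_range.2 hi, hb⟩)

theorem prints_forPowers_baseStore {z : Fin c} (hz : a z = 0) {out : ℕ → List CircuitSymbol}
    (hp : ∀ b, p.Prints (labelWidth N) (baseStore N (Function.update a z (2 ^ b))) (out b)) :
    (forPowers z p).Prints (labelWidth N) (baseStore N a)
      ((List.range (Nat.clog 2 N.sqrt)).flatMap out) := by
  have clog_le : Nat.clog 2 N.sqrt ≤ N.size :=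
    Nat.clog_le_of_le_pow ((Nat.sqrt_le_self N).trans (Nat.lt_size_self N).le)
  refine prints_forPowers hz (sqrt_lt_two_pow_labelWidth N) (clog_le.trans_lt (by
    rw [labelWidth]; omega))
    fun b _ => ?_
  rw [update_baseStore_var]
  exact hp b

theorem prints_index (ha : ∀ x, a x < N.sqrt) {x y : Fin c} (hxy : a x * N.sqrt + a y < N) :
    (Prog.seq (computeIndex x y) emitIndex).Prints (labelWidth N) (baseStore N a)
      ((a x * N.sqrt + a y).bits.map .bit) := by
  have size_lt : (a x * N.sqrt + a y).size < labelWidth N :=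
    (Nat.size_le_size hxy.le).trans_lt (Nat.lt_add_of_pos_right (by norm_num))
  have compute := runs_computeIndex (W := labelWidth N) (v := baseStore N a) rfl rfl
    (baseStore_lt_two_pow_labelWidth ha (.var x)) y
  have emit := runs_emitIndex (W := labelWidth N)
    (v := Function.update (baseStore N a) .index (a x * N.sqrt + a y))
    rfl (by simpa using size_lt)
  rw [Function.update_idem, Function.update_self,
    show Function.update (baseStore N a) .index 0 = _ from Function.update_eq_self _ _] at emit
  exact compute.seq emit

/-- Writes the label at position `p` of the assignment in the variable registers. -/
def emitLabel (p : List Bool) : RegProg c :=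
  .seq (.emit (p.map .bit)) (.op (.write fun d => (List.ofFn fun x => d (.var x)).map .bit))

theorem prints_emitLabel (p : List Bool) {v : Reg c → ℕ} (hv : v ∘ .var = a) :
    (emitLabel p : RegProg c).Prints (labelWidth N) v ((gateLabel N p a).map .bit) := by
  have label_eq : (assignmentWord (labelWidth N) a).map CircuitSymbol.bit =
      (digitVecs (labelWidth N) v).flatMap
        fun d => (List.ofFn fun x => d (.var x)).map .bit := by
    rw [assignmentWord, ← hv, ← map_comp_digitVecs, List.flatMap_map, List.map_flatMap]
    rfl
  rw [gateLabel, List.map_append, label_eq]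
  exact (Runs.emit _ v).seq (Runs.write _ v)

/-- Writes a label and a comma. -/
def emitArg (p : List Bool) : RegProg c :=
  .seq (emitLabel p) (.emit [.comma])

theorem prints_emitArg (p : List Bool) {v : Reg c → ℕ} (hv : v ∘ .var = a) :
    (emitArg p : RegProg c).Prints (labelWidth N) v
      ((gateLabel N p a).map .bit ++ [.comma]) :=
  (prints_emitLabel p hv).seq (Runs.emit _ v)

/-- Writes the label of an output. -/
def emitOutput (p : List Bool) : RegProg c :=
  .seq (.emit [.output]) (emitLabel p)

theorem prints_emitOutput (p : List Bool) (a : Fin c → ℕ) :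
    (emitOutput p : RegProg c).Prints (labelWidth N) (baseStore N a)
      (.output :: (gateLabel N p a).map .bit) :=
  (Runs.emit [CircuitSymbol.output] _).seq (prints_emitLabel (a := a) p rfl)

end RegProg

namespace Formula

open RegProg

/-- All numerical predicates in the formula are decided by passes over the binary digits. -/
def IsUniform : Formula c → Prop
  | adj _ _ => True
  | num q => ∃ M : SweepOp (Reg c) CircuitSymbol, ∀ (W : ℕ) (v : Reg c → ℕ),
      (∀ r, v r < 2 ^ W) → M.Decides W v (q fun x => v (.var x))
  | not φ => φ.IsUniform
  | and φ ψ => φ.IsUniform ∧ ψ.IsUniform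
  | ex _ φ => φ.IsUniform

theorem exists_prints_topOp {φ : Formula c} (hφ : φ.IsUniform) (p : List Bool) :
    ∃ P : RegProg c, ∀ (N : ℕ) (a : Fin c → ℕ), (∀ x, a x < N.sqrt) →
      P.Prints (labelWidth N) (baseStore N a) (φ.topOp N p a).encode := by
  cases φ with
  | adj x y =>
    refine ⟨.seq (.emit [.input]) (.seq (computeIndex x y) emitIndex), fun N a ha => ?_⟩
    have index_lt : a x * N.sqrt + a y < N := by
      have := Nat.sqrt_le N
      have := Nat.mul_le_mul_right N.sqrt (Nat.succ_le_iff.2 (ha x))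
      have := ha y
      rw [Nat.succ_mul] at *
      omega
    simp only [topOp, inputOp, index_lt, dite_true, GateOp.encode]
    exact (Runs.emit [.input] _).seq (prints_index ha index_lt)
  | num q =>
    obtain ⟨M, hM⟩ := hφ
    refine ⟨.ite M (.emit [.and]) (.emit [.or]), fun N a ha => ?_⟩
    refine Runs.ite (hM _ _ (baseStore_lt_two_pow_labelWidth ha)) (fun hq => ?_) (fun hq => ?_) <;>
      · change q a = _ at hq
        simpa [topOp, hq, GateOp.encode] using Runs.emit _ _
  | not φ =>
    exact ⟨.seq (.emit [.not]) (emitLabel (p ++ [false])), fun N a _ =>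
      (Runs.emit [.not] _).seq (prints_emitLabel _ rfl)⟩
  | and φ ψ =>
    refine ⟨.seq (.emit [.and]) (.seq (emitArg (p ++ [false])) (emitArg (p ++ [true]))),
      fun N a _ => ?_⟩
    simpa [topOp, GateOp.encode] using
      (Runs.emit [.and] (baseStore N a)).seq
        ((prints_emitArg (a := a) _ rfl).seq (prints_emitArg (a := a) _ rfl))
  | ex x φ =>
    refine ⟨.seq (.emit [.or]) (forVarRestoring x (emitArg (p ++ [false]))), fun N a _ => ?_⟩
    rw [topOp, GateOp.encode, List.flatMap_map]
    refine (Runs.emit [.or] _).seq (prints_forVarRestoring (v := baseStore N a) rfl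
      (sqrt_lt_two_pow_labelWidth N) fun i _ => prints_emitArg _ ?_)
    funext y
    simp [Function.update_apply, baseStore]

theorem exists_prints_gate {φ : Formula c} (hφ : φ.IsUniform) (p : List Bool) :
    ∃ P : RegProg c, ∀ (N : ℕ) (a : Fin c → ℕ), (∀ x, a x < N.sqrt) →
      P.Prints (labelWidth N) (baseStore N a) (Gate.encode ⟨gateLabel N p a, φ.topOp N p a⟩) := by
  obtain ⟨P, hP⟩ := exists_prints_topOp hφ p
  refine ⟨.seq (emitLabel p) (.seq P (.emit [.endGate])), fun N a ha => ?_⟩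
  rw [Gate.encode, List.append_assoc]
  exact (prints_emitLabel p rfl).seq ((hP N a ha).seq (Runs.emit _ _))

theorem exists_prints_gates_of_subGates {φ : Formula c} (hφ : φ.IsUniform) {p : List Bool}
    {P₀ : RegProg c} (h : ∀ N : ℕ, P₀.Prints (labelWidth N) (baseStore N 0)
      ((φ.subGates N p).flatMap Gate.encode)) :
    ∃ P : RegProg c, ∀ N : ℕ, P.Prints (labelWidth N) (baseStore N 0)
      ((φ.gates N p).flatMap Gate.encode) := by
  obtain ⟨P, hP⟩ := exists_prints_gate hφ p
  refine ⟨.seq P₀ (forAssignments (List.finRange c) P), fun N => ?_⟩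
  rw [gates_eq, List.flatMap_append, gateLayer, List.flatMap_map]
  exact (h N).seq (prints_forAssignments (List.nodup_finRange c) (fun _ _ => rfl)
    fun b hb => hP N b (mem_allAssignments.1 hb))

theorem exists_prints_gates {φ : Formula c} (hφ : φ.IsUniform) (p : List Bool) :
    ∃ P : RegProg c, ∀ N : ℕ, P.Prints (labelWidth N) (baseStore N 0)
      ((φ.gates N p).flatMap Gate.encode) := by
  induction φ generalizing p with
  | adj x y => exact exists_prints_gates_of_subGates hφ fun N => Runs.emit [] _
  | num q => exact exists_prints_gates_of_subGates hφ fun N => Runs.emit [] _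
  | not φ ih =>
    obtain ⟨P, hP⟩ := ih hφ (p ++ [false])
    exact exists_prints_gates_of_subGates hφ hP
  | and φ ψ ihφ ihψ =>
    obtain ⟨P, hP⟩ := ihφ hφ.1 (p ++ [false])
    obtain ⟨P', hP'⟩ := ihψ hφ.2 (p ++ [true])
    refine exists_prints_gates_of_subGates (P₀ := .seq P P') hφ fun N => ?_
    rw [subGates, List.flatMap_append]
    exact (hP N).seq (hP' N)
  | ex x φ ih =>
    obtain ⟨P, hP⟩ := ih hφ (p ++ [false])
    exact exists_prints_gates_of_subGates hφ hP

theorem isUniform_eq (x y : Fin c) : (eq x y).IsUniform :=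
  ⟨.eq (.var x) (.var y), fun _ _ h => SweepOp.decides_eq (h _) (h _)⟩

theorem isUniform_lt (x y : Fin c) : (lt x y).IsUniform :=
  ⟨.lt (.var x) (.var y), fun _ _ h => SweepOp.decides_lt (h _) (h _)⟩

theorem isUniform_meet (x y : Fin c) : (meet x y).IsUniform :=
  ⟨.meet (.var x) (.var y), fun _ _ h => SweepOp.decides_meet (h _) (h _)⟩

end Formula

/-! ### Logspace uniformity -/

section Uniformity

variable {x y z : Fin c} {φ ψ : Formula c}

open RegProg in
theorem exists_runs_queryCircuit (hxy : x ≠ y) (hxz : x ≠ z) (hyz : y ≠ z)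
    (hφ : φ.IsUniform) (hψ : ψ.IsUniform) :
    ∃ P : RegProg c, ∀ N : ℕ, P.Runs (labelWidth N) (inputStore N) (baseStore N 0)
      (queryCircuit N x y z φ ψ).encode := by
  obtain ⟨P, hP⟩ := Formula.exists_prints_gates hφ [false]
  obtain ⟨P', hP'⟩ := Formula.exists_prints_gates hψ [true]
  refine ⟨.seq computeSqrt (.seq (.seq P P') (.seq (forVar x (emitOutput [false]))
    (forVar x (forVar y (forPowers z (emitOutput [true])))))), fun N => ?_⟩
  have hsqrt := runs_computeSqrt (c := c) (W := labelWidth N) (v := inputStore N)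
    rfl rfl (eight_mul_lt_two_pow_labelWidth N)
  have hbase : Function.update (inputStore N) .vertices N.sqrt = baseStore (c := c) N 0 := by
    funext r
    cases r <;> rfl
  rw [show inputStore N Reg.input = N from rfl, hbase] at hsqrt
  have hindex := prints_forVar_baseStore (N := N) (a := 0) (x := x) rfl
    fun u _ => prints_emitOutput [false] _
  have hentries := prints_forVar_baseStore (N := N) (a := 0) (x := x) rfl fun u _ =>
    prints_forVar_baseStore (a := Function.update 0 x u) (x := y) (by simp [hxy.symm]) fun w _ =>
      prints_forPowers_baseStore (z := z) (by simp [hyz.symm, hxz.symm]) fun b =>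
        prints_emitOutput [true] _
  simpa [Circuit.encode, queryCircuit, List.flatMap_map, List.flatMap_assoc] using
    hsqrt.seq (((hP N).seq (hP' N)).seq (hindex.seq hentries))

/-- Writes the word `ws[N]` for inputs of length `N < ws.length`, and runs `p` on all others. The
register `index` counts the words that have been skipped. -/
def RegProg.withExceptions (p : RegProg c) : List (List CircuitSymbol) → RegProg c
  | [] => .seq (.op (.zero .index)) p
  | w :: ws => .ite (.eq .index .input) (.emit w) (.seq (.op (.inc .index)) (withExceptions p ws))

theorem RegProg.runs_withExceptions {W : ℕ} {p : RegProg c} {v : Reg c → ℕ}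
    (hindex : v .index = 0) (hinput : v .input = N) (hN : N < 2 ^ W) {o : List CircuitSymbol}
    {ws : List (List CircuitSymbol)} {t : ℕ} (ht : t ≤ N)
    (hp : t + ws.length ≤ N → ∃ v', p.Runs W v v' o)
    (hws : ∀ h : N - t < ws.length, ws[N - t] = o) :
    ∃ v', (p.withExceptions ws).Runs W (Function.update v .index t) v' o := by
  induction ws generalizing t with
  | nil =>
    obtain ⟨v', hv'⟩ := hp ht
    have hreset : Function.update (Function.update v .index t) .index 0 = v := by
      rw [Function.update_idem, Function.update_eq_self_iff.2 hindex.symm]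
    exact ⟨v', (Runs.zero hreset).seq hv'⟩
  | cons w ws ih =>
    have hM : (SweepOp.eq .index .input : SweepOp (Reg c) CircuitSymbol).Decides W
        (Function.update v .index t) (decide (t = N)) := by
      simpa [hinput] using SweepOp.decides_eq (v := Function.update v .index t) (x := .index)
        (y := .input) (by simpa using ht.trans_lt hN) (by simpa [hinput] using hN)
    rcases ht.eq_or_lt with rfl | ht
    · obtain rfl : w = o := by simpa using hws
      exact ⟨_, Runs.ite hM (fun _ => Runs.emit _ _) (fun h => by simp at h)⟩
    · obtain ⟨v', hv'⟩ := ih (t := t + 1) ht (fun h => hp (by rw [List.length_cons]; omega))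
        (fun h => by
          rw [← hws (by rw [List.length_cons]; omega)]
          simp only [show N - t = N - (t + 1) + 1 by omega, List.getElem_cons_succ])
      refine ⟨v', Runs.ite hM (fun h => absurd (of_decide_eq_true h) ht.ne) (fun _ => ?_)⟩
      exact (Runs.inc (by simp)).seq hv'

theorem logspaceUniform_of_eventually_queryCircuit (hxy : x ≠ y) (hxz : x ≠ z) (hyz : y ≠ z)
    (hφ : φ.IsUniform) (hψ : ψ.IsUniform) {C : (N : ℕ) → Circuit N} {B : ℕ}
    (hC : ∀ N, B ≤ N → C N = queryCircuit N x y z φ ψ) : LogspaceUniform C := by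
  obtain ⟨P, hP⟩ := exists_runs_queryCircuit hxy hxz hyz hφ hψ
  let ws : List (List CircuitSymbol) := (List.range B).map fun N => (C N).encode
  refine ⟨progMachine .input (P.withExceptions ws), 6, fun N => ?_⟩
  obtain ⟨v, hv⟩ := RegProg.runs_withExceptions (N := N) (p := P) (v := inputStore N)
    (W := labelWidth N) (o := (C N).encode) (ws := ws) (t := 0) rfl rfl
    (lt_two_pow_labelWidth N) (Nat.zero_le N)
    (fun h => by
      rw [hC N (by simpa [ws] using h)]
      exact ⟨_, hP N⟩)
    (fun h => by
      simp only [ws, List.getElem_map]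
      exact congrArg (fun k => (C k).encode) (by simp))
  rw [Function.update_eq_self_iff.2 (show _ = inputStore N .index from rfl)] at hv
  refine progMachine_outputsInSpace (l := digitVecs (labelWidth N) v) ?_
  rw [startWord_eq_digitVecs]
  exact hv

end Uniformity

end Programs

namespace LatinFormula

open Formula

theorem isUniform_onLine (p q w : Fin 13) : (onLine p q w).IsUniform := by
  simp only [onLine, Formula.or, Formula.IsUniform, isUniform_eq, and_self]

theorem isUniform_sameClass (o u p q : Fin 13) : (sameClass o u p q).IsUniform := by
  simp only [sameClass, Formula.or, Formula.IsUniform, isUniform_eq, isUniform_onLine, and_self]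

theorem isUniform_thirdClass (o u v p q : Fin 13) : (thirdClass o u v p q).IsUniform := by
  simp only [thirdClass, Formula.or, Formula.IsUniform, isUniform_eq, isUniform_sameClass, and_self]

theorem isUniform_entry (o u v x y z : Fin 13) : (entry o u v x y z).IsUniform := by
  simp only [entry, Formula.IsUniform, isUniform_sameClass, isUniform_thirdClass, and_self]

theorem isUniform_base : base.IsUniform := by
  simp only [base, Formula.IsUniform, isUniform_lt, and_self]

theorem isUniform_second : second.IsUniform := by
  simp only [second, Formula.IsUniform, isUniform_lt, isUniform_sameClass, and_self]

theorem isUniform_index : index.IsUniform := by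
  simp only [index, Formula.IsUniform, isUniform_base, isUniform_sameClass, and_self]

theorem isUniform_entryDigit : entryDigit.IsUniform := by
  simp only [entryDigit, Formula.IsUniform, isUniform_base, isUniform_second, isUniform_entry,
    isUniform_meet, and_self]

end LatinFormula

/-! ### The circuit family -/

section Family

variable {c : ℕ} {x y z : Fin c}

theorem queryCircuit_recovers {n : ℕ} (hxy : x ≠ y) (hxz : x ≠ z) (hyz : y ≠ z) {φ ψ : Formula c}
    (hrec : Recovers n x y z φ ψ) {L : Fin n → Fin n → Fin n} (hL : IsLatinSquare L)
    {G : SimpleGraph (Fin (n ^ 2))} (hG : Nonempty (G ≃g latinSquareGraph L)) :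
    ∃ (S : Finset (Fin (n ^ 2))) (L' : S → S → S),
      G.IsNClique n S ∧ IsLatinSquare L' ∧ Nonempty (G ≃g latinSquareGraph L') ∧
      (queryCircuit (n ^ 2 * n ^ 2) x y z φ ψ).eval (adjacencyString G) =
        latinSquareString S L' := by
  obtain ⟨S, L', ⟨hS, hL', hiso⟩, hφ, hψ⟩ := hrec L hL G hG
  rw [← inputRel_adjacencyString G] at hφ hψ
  exact ⟨S, L', hS, hL', hiso, queryCircuit_eval (Nat.sqrt_eq (n ^ 2)) hxy hxz hyz hφ hψ⟩

theorem exists_bound_of_eventually_const {f : ℕ → ℕ} {B k : ℕ} (h : ∀ N, B ≤ N → f N = k) :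
    ∃ d, ∀ N, f N ≤ d := by
  refine ⟨max k ((Finset.range B).sup f), fun N => ?_⟩
  rcases le_or_gt B N with hN | hN
  · exact (h N hN).trans_le (le_max_left _ _)
  · exact (Finset.le_sup (Finset.mem_range.2 hN)).trans (le_max_right _ _)

theorem isUniformAC0_queryCircuit (hxy : x ≠ y) (hxz : x ≠ z) (hyz : y ≠ z) {φ ψ : ℕ → Formula c}
    {φ' ψ' : Formula c} {B : ℕ} (hφ : ∀ N, B ≤ N → φ N = φ') (hψ : ∀ N, B ≤ N → ψ N = ψ')
    (uniform_φ : φ'.IsUniform) (uniform_ψ : ψ'.IsUniform) :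
    IsUniformAC0 fun N => queryCircuit N x y z (φ N) (ψ N) := by
  obtain ⟨d, hd⟩ := exists_bound_of_eventually_const
    (f := fun N => max (φ N).height (ψ N).height) fun N hN => by rw [hφ N hN, hψ N hN]
  obtain ⟨k, hk⟩ := exists_bound_of_eventually_const
    (f := fun N => (φ N).nodes + (ψ N).nodes + c) fun N hN => by rw [hφ N hN, hψ N hN]
  exact ⟨fun N => queryCircuit_wellFormed, ⟨d, fun N => queryCircuit_depth_le.trans (hd N)⟩,
    ⟨k, fun N => queryCircuit_size_le (hk N)⟩,
    logspaceUniform_of_eventually_queryCircuit hxy hxz hyz uniform_φ uniform_ψ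
      fun N hN => by rw [hφ N hN, hψ N hN]⟩

theorem exists_eventually_const_recovers :
    ∃ (φ ψ : ℕ → Formula 13) (B : ℕ),
      (∀ N, B ≤ N → φ N = LatinFormula.index) ∧ (∀ N, B ≤ N → ψ N = LatinFormula.entryDigit) ∧
      ∀ n, Recovers n 0 1 2 (φ (n ^ 2 * n ^ 2)) (ψ (n ^ 2 * n ^ 2)) := by
  choose φ ψ hrec using fun n => exists_recovers (c := 13) (by decide) n 0 1 2
  refine ⟨fun N => if 5 ≤ N.sqrt.sqrt then LatinFormula.index else φ N.sqrt.sqrt,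
    fun N => if 5 ≤ N.sqrt.sqrt then LatinFormula.entryDigit else ψ N.sqrt.sqrt, 5 ^ 2 * 5 ^ 2,
    fun N hN => if_pos ?_, fun N hN => if_pos ?_, fun n => ?_⟩
  · exact Nat.le_sqrt'.2 (Nat.le_sqrt.2 hN)
  · exact Nat.le_sqrt'.2 (Nat.le_sqrt.2 hN)
  · simp only [Nat.sqrt_eq, Nat.sqrt_eq']
    split_ifs with hn
    · exact recovers_index_entryDigit hn
    · exact hrec n

end Family

theorem mainTheorem8 :
    ∃ C : (N : ℕ) → Circuit N, IsUniformAC0 C ∧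
      ∀ (n : ℕ) (L : Fin n → Fin n → Fin n), IsLatinSquare L →
        ∀ G : SimpleGraph (Fin (n ^ 2)), Nonempty (G ≃g latinSquareGraph L) →
          ∃ (S : Finset (Fin (n ^ 2))) (L' : S → S → S),
            G.IsNClique n S ∧ IsLatinSquare L' ∧ Nonempty (G ≃g latinSquareGraph L') ∧
            (C (n ^ 2 * n ^ 2)).eval (adjacencyString G) = latinSquareString S L' := by
  obtain ⟨φ, ψ, B, hφ, hψ, hrec⟩ := exists_eventually_const_recovers
  have h01 : (0 : Fin 13) ≠ 1 := by decide
  have h02 : (0 : Fin 13) ≠ 2 := by decide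
  have h12 : (1 : Fin 13) ≠ 2 := by decide
  exact ⟨fun N => queryCircuit N 0 1 2 (φ N) (ψ N),
    isUniformAC0_queryCircuit h01 h02 h12 hφ hψ LatinFormula.isUniform_index
      LatinFormula.isUniform_entryDigit,
    fun n L hL G hG => queryCircuit_recovers h01 h02 h12 (hrec n) hL hG⟩
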